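/- Let $k$ be an algebraically closed field and let $Q$ be a finite quiver with vertex set $Q_0$ and arrow set $Q_1$. Let $kQ$ be its path algebra, let $J(Q)\subset kQ$ be the two-sided ideal generated by the arrows, and let $I$ be an admissible ideal of $kQ$, i.e. a two-sided ideal with $J(Q)^2\supseteq I\supseteq J(Q)^{\ell}$ for some $\ell\ge 2$. Put $B=kQ/I$ and $T_2Q=kQ/J(Q)^2$, and let $\operatorname{msa}(Q)$ be the set of all unital $k$-subalgebras of $T_2Q$ of dimension $\dim_k T_2Q-1$. Every $k$-algebra automorphism of $B$ preserves $J(Q)^2/I$ (the square of the Jacobson radical of $B$) and so induces an automorphism of $T_2Q$; through the resulting homomorphism $\operatorname{Aut}_k(B)\to\operatorname{Aut}_k(T_2Q)$ the group $\operatorname{Aut}_k(B)$ acts on $\operatorname{msa}(Q)$. For vertices $u,v$ let $ukQ_1v\subset kQ$ be the $k$-span of the arrows from $u$ to $v$ (which embeds in $T_2Q$), let $d(u,v)=\dim_k ukQ_1v$, and let $V^2(Q)$ be the set of pairs $(u,v)\in Q_0\times Q_0$ for which there is at least one arrow from $u$ to $v$. Let $H_B$ be the group of all $\phi\in\operatorname{Aut}_k(B)$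 that fix (the class of) every vertex of $Q$. For $\phi\in H_B$ the induced automorphism of $T_2Q$ maps $ukQ_1v$ onto itself; let $H_B(u,v)\le \operatorname{GL}(ukQ_1v)$ be the image of the resulting homomorphism $H_B\to\operatorname{GL}(ukQ_1v)$. Then there are finitely many $\operatorname{Aut}_k(B)$-orbits on $\operatorname{msa}(Q)$ if and only if, for each $(u,v)\in V^2(Q)$, there are finitely many $H_B(u,v)$-orbits on the Grassmannian $\operatorname{Gr}_{d(u,v)-1}(ukQ_1v)$ of codimension-one subspaces of $ukQ_1v$. -/

import Mathlib

universe u v w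

set_option linter.unusedSectionVars false

/-! ### Path algebras -/

/-- A path of the quiver `Q`, together with its source and its target. -/
structure BPath (Q : Type v) [Quiver.{w} Q] where
  src : Q
  tgt : Q
  path : Quiver.Path src tgt

/-- The underlying space of the path algebra `kQ`: the vector space with basis the paths. -/
def PathAlgebra (k : Type u) (Q : Type v) [Field k] [Quiver.{w} Q] : Type max u v w :=
  BPath Q →₀ k

namespace PathAlgebra

noncomputable section

variable (k : Type u) {Q : Type v} [Field k] [Quiver.{w} Q]

instance : AddCommGroup (PathAlgebra k Q) := inferInstanceAs (AddCommGroup (BPath Q →₀ k))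

instance : Module k (PathAlgebra k Q) := inferInstanceAs (Module k (BPath Q →₀ k))

/-- The paths form a basis of `kQ`. -/
def pathBasis (Q : Type v) [Quiver.{w} Q] : Module.Basis (BPath Q) k (PathAlgebra k Q) :=
  Module.Basis.ofRepr (LinearEquiv.refl k (BPath Q →₀ k))

/-- The basis element of `kQ` given by a path. -/
def ofPath (p : BPath Q) : PathAlgebra k Q := pathBasis k Q p

/-- The stationary path at the vertex `v`. -/
def vertex (v : Q) : PathAlgebra k Q := ofPath k ⟨v, v, Quiver.Path.nil⟩

/-- The path of length one given by an arrow. -/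
def arrow {u v : Q} (a : u ⟶ v) : PathAlgebra k Q := ofPath k ⟨u, v, a.toPath⟩

open Classical in
/-- The product of two paths in `kQ`: "first `p`, then `q`" if the target of `p` is the
source of `q`, and zero otherwise. -/
def pathMul (p q : BPath Q) : PathAlgebra k Q :=
  if h : q.src = p.tgt then ofPath k ⟨p.src, q.tgt, p.path.comp (q.path.cast h rfl)⟩ else 0

/-- The bilinear extension of the product of paths. -/
def mulLin : PathAlgebra k Q →ₗ[k] PathAlgebra k Q →ₗ[k] PathAlgebra k Q :=
  (pathBasis k Q).constr k fun p => (pathBasis k Q).constr k fun q => pathMul k p q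

variable {k}

theorem mulLin_ofPath (p q : BPath Q) : mulLin k (ofPath k p) (ofPath k q) = pathMul k p q := by
  rw [mulLin, ofPath, ofPath, Module.Basis.constr_basis, Module.Basis.constr_basis]

theorem pathMul_comp {a b c : Q} (p : Quiver.Path a b) (q : Quiver.Path b c) :
    pathMul k ⟨a, b, p⟩ ⟨b, c, q⟩ = ofPath k ⟨a, c, p.comp q⟩ := by
  simp [pathMul]

theorem pathMul_ne {p q : BPath Q} (h : q.src ≠ p.tgt) : pathMul k p q = 0 := by
  simp [pathMul, h]

theorem span_ofPath : Submodule.span k (Set.range (ofPath (Q := Q) k)) = ⊤ :=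
  (pathBasis k Q).span_eq

theorem hom_ext {M : Type*} [AddCommMonoid M] [Module k M] {f g : PathAlgebra k Q →ₗ[k] M}
    (h : ∀ p, f (ofPath k p) = g (ofPath k p)) : f = g :=
  (pathBasis k Q).ext h

instance : Mul (PathAlgebra k Q) := ⟨fun x y => mulLin k x y⟩

theorem mul_def (x y : PathAlgebra k Q) : x * y = mulLin k x y := rfl

theorem ofPath_mul (p q : BPath Q) : ofPath k p * ofPath k q = pathMul k p q :=
  mulLin_ofPath p q

theorem mul_assoc_aux (x y z : PathAlgebra k Q) :
    mulLin k (mulLin k x y) z = mulLin k x (mulLin k y z) := by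
  have h : (mulLin k).compr₂ (mulLin k (Q := Q)) =
      (LinearMap.llcomp k (PathAlgebra k Q) (PathAlgebra k Q) (PathAlgebra k Q) ∘ₗ
        mulLin k).compl₂ (mulLin k) := by
    refine hom_ext fun p => hom_ext fun q => hom_ext fun r => ?_
    obtain ⟨p₁, p₂, p⟩ := p
    obtain ⟨q₁, q₂, q⟩ := q
    obtain ⟨r₁, r₂, r⟩ := r
    simp only [LinearMap.compr₂_apply, LinearMap.compl₂_apply, LinearMap.comp_apply,
      LinearMap.llcomp_apply, mulLin_ofPath]
    by_cases h₁ : q₁ = p₂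
    · subst h₁
      by_cases h₂ : r₁ = q₂
      · subst h₂
        simp [pathMul_comp, mulLin_ofPath, Quiver.Path.comp_assoc]
      · rw [pathMul_comp, mulLin_ofPath, pathMul_ne h₂, pathMul_ne h₂, map_zero]
    · rw [pathMul_ne (k := k) (p := ⟨p₁, p₂, p⟩) (q := ⟨q₁, q₂, q⟩) h₁]
      by_cases h₂ : r₁ = q₂
      · subst h₂
        rw [pathMul_comp, mulLin_ofPath, pathMul_ne (by exact h₁)]
        simp
      · rw [pathMul_ne (k := k) (p := ⟨q₁, q₂, q⟩) (q := ⟨r₁, r₂, r⟩) h₂]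
        simp
  exact congrArg (fun F => F x y z) h

variable [Fintype Q]

instance : One (PathAlgebra k Q) := ⟨∑ v : Q, vertex k v⟩

theorem one_def : (1 : PathAlgebra k Q) = ∑ v : Q, vertex k v := rfl

theorem one_mul_aux (x : PathAlgebra k Q) : mulLin k (∑ v : Q, vertex k v) x = x := by
  classical
  have h : mulLin k (∑ v : Q, vertex k v) = LinearMap.id := by
    refine hom_ext fun p => ?_
    obtain ⟨a, b, p⟩ := p
    rw [map_sum, LinearMap.sum_apply, Finset.sum_eq_single a]
    · rw [vertex, mulLin_ofPath, pathMul_comp]; simp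
    · intro c _ hc
      rw [vertex, mulLin_ofPath, pathMul_ne]
      exact fun h => hc h.symm
    · simp
  rw [h]; rfl

theorem mul_one_aux (x : PathAlgebra k Q) : mulLin k x (∑ v : Q, vertex k v) = x := by
  classical
  have h : (mulLin k).flip (∑ v : Q, vertex k v) = LinearMap.id := by
    refine hom_ext fun p => ?_
    obtain ⟨a, b, p⟩ := p
    rw [LinearMap.flip_apply, map_sum, Finset.sum_eq_single b]
    · rw [vertex, mulLin_ofPath, pathMul_comp]; simp
    · intro c _ hc
      rw [vertex, mulLin_ofPath, pathMul_ne]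
      exact fun h => hc h
    · simp
  exact congrArg (fun F => F x) h

instance : Ring (PathAlgebra k Q) :=
  { (inferInstance : AddCommGroup (PathAlgebra k Q)) with
    mul := (· * ·)
    one := 1
    left_distrib := fun x y z => map_add (mulLin k x) y z
    right_distrib := fun x y z => by simp only [mul_def, map_add, LinearMap.add_apply]
    zero_mul := fun x => by simp only [mul_def, map_zero, LinearMap.zero_apply]
    mul_zero := fun x => map_zero (mulLin k x)
    mul_assoc := mul_assoc_aux
    one_mul := one_mul_aux
    mul_one := mul_one_aux }

instance : Algebra k (PathAlgebra k Q) :=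
  Algebra.ofModule
    (fun a x y => by simp only [mul_def, map_smul, LinearMap.smul_apply])
    (fun a x y => by simp only [mul_def, map_smul])

end

end PathAlgebra

/-! ### The arrow ideal, admissible ideals and truncated quiver algebras -/

section

open PathAlgebra

variable (k : Type u) (Q : Type v) [Field k] [Quiver.{w} Q] [Fintype Q]

/-- The two-sided ideal `J(Q)` of `kQ` generated by the arrows. -/
noncomputable def arrowIdeal : Ideal (PathAlgebra k Q) :=
  (TwoSidedIdeal.span {x : PathAlgebra k Q | ∃ (u v : Q) (a : u ⟶ v), x = arrow k a}).asIdeal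

instance : (arrowIdeal k Q).IsTwoSided := by unfold arrowIdeal; infer_instance

/-- The truncated quiver algebra `T_n Q = kQ / J(Q)^n`. -/
abbrev TruncatedAlgebra (n : ℕ) : Type max u v w := PathAlgebra k Q ⧸ (arrowIdeal k Q ^ n)

variable {k Q}

/-- Admissible ideals of `kQ`: `J(Q)^2 ⊇ I ⊇ J(Q)^ℓ` for some `ℓ ≥ 2`. -/
structure IsAdmissible (I : Ideal (PathAlgebra k Q)) : Prop where
  le_sq : I ≤ arrowIdeal k Q ^ 2
  pow_le : ∃ l : ℕ, 2 ≤ l ∧ arrowIdeal k Q ^ l ≤ I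

end

/-! ### Facts about lengths of paths, needed to see that automorphisms of `kQ/I` act on `T_2 Q` -/

namespace PathAlgebra

noncomputable section

variable {k : Type u} {Q : Type v} [Field k] [Quiver.{w} Q]

/-- The span of the paths of length at least `n`. -/
def filt (k : Type u) (Q : Type v) [Field k] [Quiver.{w} Q] (n : ℕ) :
    Submodule k (PathAlgebra k Q) :=
  Submodule.span k (ofPath k '' {p : BPath Q | n ≤ p.path.length})

/-- The coefficient of a path in an element of `kQ`. -/
def coeff (p : BPath Q) : PathAlgebra k Q →ₗ[k] k := (pathBasis k Q).coord p

theorem coeff_self (p : BPath Q) : coeff p (ofPath k p) = 1 := by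
  simp [coeff, ofPath]

theorem coeff_ne {p q : BPath Q} (h : p ≠ q) : coeff p (ofPath k q) = 0 := by
  simp [coeff, ofPath, h.symm]

theorem ext_coeff {x y : PathAlgebra k Q} (h : ∀ p, coeff p x = coeff p y) : x = y :=
  (pathBasis k Q).ext_elem h

theorem coeff_of_filt {n : ℕ} {x : PathAlgebra k Q} (hx : x ∈ filt k Q n) {p : BPath Q}
    (hp : p.path.length < n) : coeff p x = 0 := by
  have : filt k Q n ≤ LinearMap.ker (coeff (k := k) p) := by
    refine Submodule.span_le.2 ?_
    rintro _ ⟨q, hq, rfl⟩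
    refine coeff_ne ?_
    rintro rfl
    exact absurd hq (not_le.2 hp)
  exact this hx

theorem mem_filt_one {x : PathAlgebra k Q}
    (hx : ∀ v : Q, coeff ⟨v, v, Quiver.Path.nil⟩ x = 0) : x ∈ filt k Q 1 := by
  rw [← (pathBasis k Q).linearCombination_repr x]
  refine Submodule.sum_mem _ ?_
  rintro ⟨a, b, p⟩ hp
  cases p with
  | nil => exact absurd (hx a) (Finsupp.mem_support_iff.1 hp)
  | cons p e =>
    exact Submodule.smul_mem _ _ (Submodule.subset_span ⟨_, by simp, rfl⟩)

variable [Fintype Q]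

theorem filt_mul {m n : ℕ} {x y : PathAlgebra k Q} (hx : x ∈ filt k Q m) (hy : y ∈ filt k Q n) :
    x * y ∈ filt k Q (m + n) := by
  have : filt k Q m * filt k Q n ≤ filt k Q (m + n) := by
    unfold filt
    rw [Submodule.span_mul_span, Submodule.span_le]
    rintro _ ⟨_, ⟨⟨a, b, p⟩, hp, rfl⟩, _, ⟨⟨c, d, q⟩, hq, rfl⟩, rfl⟩
    simp only [Set.mem_ofPred_eq] at hp hq
    change ofPath k _ * ofPath k _ ∈ _
    rw [ofPath_mul]
    by_cases h : c = b
    · subst h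
      rw [pathMul_comp]
      refine Submodule.subset_span ⟨_, ?_, rfl⟩
      simp only [Set.mem_ofPred_eq, Quiver.Path.length_comp]
      omega
    · rw [pathMul_ne h]
      exact Submodule.zero_mem _
  exact this (Submodule.mul_mem_mul hx hy)

theorem mem_filt_zero (x : PathAlgebra k Q) : x ∈ filt k Q 0 := by
  have : filt k Q 0 = ⊤ := by
    rw [← span_ofPath, filt]
    simp
  rw [this]; trivial

/-- `filt` as an ideal. -/
def filtIdeal (k : Type u) (Q : Type v) [Field k] [Quiver.{w} Q] [Fintype Q] (n : ℕ) :
    Ideal (PathAlgebra k Q) where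
  carrier := filt k Q n
  add_mem' := fun ha hb => Submodule.add_mem _ ha hb
  zero_mem' := Submodule.zero_mem _
  smul_mem' := fun c x hx => by simpa using filt_mul (mem_filt_zero c) hx

instance (n : ℕ) : (filtIdeal k Q n).IsTwoSided :=
  ⟨fun {a} b hx => show a * b ∈ filt k Q n by simpa using filt_mul hx (mem_filt_zero b)⟩

theorem arrow_mem {u v : Q} (a : u ⟶ v) : arrow k a ∈ arrowIdeal k Q := by
  unfold arrowIdeal
  rw [TwoSidedIdeal.mem_asIdeal]
  exact TwoSidedIdeal.subset_span ⟨u, v, a, rfl⟩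

theorem arrowIdeal_le : arrowIdeal k Q ≤ filtIdeal k Q 1 := by
  intro x hx
  unfold arrowIdeal at hx
  rw [TwoSidedIdeal.mem_asIdeal, TwoSidedIdeal.mem_span_iff] at hx
  have := hx (filtIdeal k Q 1).toTwoSided (by
    rintro _ ⟨u, v, a, rfl⟩
    simp only [SetLike.mem_coe, Ideal.mem_toTwoSided]
    exact Submodule.subset_span ⟨_, by simp, rfl⟩)
  simpa using this

theorem sq_eq : arrowIdeal k Q ^ 2 = arrowIdeal k Q * arrowIdeal k Q := by
  rw [Ideal.IsTwoSided.pow_succ, Submodule.pow_one]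

theorem sq_le : arrowIdeal k Q ^ 2 ≤ filtIdeal k Q 2 := by
  rw [sq_eq, Ideal.mul_le]
  intro r hr s hs
  exact filt_mul (m := 1) (n := 1) (arrowIdeal_le hr) (arrowIdeal_le hs)

theorem ofPath_cons {a b c : Q} (p : Quiver.Path a b) (e : b ⟶ c) :
    ofPath k ⟨a, c, p.cons e⟩ = ofPath k ⟨a, b, p⟩ * arrow k e := by
  rw [arrow, ofPath_mul, pathMul_comp]
  rfl

theorem ofPath_mem {p : BPath Q} (hp : 1 ≤ p.path.length) : ofPath k p ∈ arrowIdeal k Q := by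
  obtain ⟨a, b, p⟩ := p
  cases p with
  | nil => simp at hp
  | cons p e =>
    rw [ofPath_cons]
    exact Ideal.mul_mem_left _ _ (arrow_mem e)

theorem ofPath_mem_sq {p : BPath Q} (hp : 2 ≤ p.path.length) :
    ofPath k p ∈ arrowIdeal k Q ^ 2 := by
  obtain ⟨a, b, p⟩ := p
  cases p with
  | nil => simp at hp
  | cons p e =>
    rw [ofPath_cons, sq_eq]
    refine Ideal.mul_mem_mul (ofPath_mem ?_) (arrow_mem e)
    simp only [Quiver.Path.length_cons] at hp
    simp only
    omega

theorem filt_one_le {x : PathAlgebra k Q} (hx : x ∈ filt k Q 1) : x ∈ arrowIdeal k Q := by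
  have : filt k Q 1 ≤ (arrowIdeal k Q).restrictScalars k := by
    refine Submodule.span_le.2 ?_
    rintro _ ⟨p, hp, rfl⟩
    exact ofPath_mem hp
  exact this hx

theorem coeff_nil_mul (v : Q) (x y : PathAlgebra k Q) :
    coeff ⟨v, v, Quiver.Path.nil⟩ (x * y) =
      coeff ⟨v, v, Quiver.Path.nil⟩ x * coeff ⟨v, v, Quiver.Path.nil⟩ y := by
  have h : (mulLin k).compr₂ (coeff (k := k) (⟨v, v, Quiver.Path.nil⟩ : BPath Q)) =
      (LinearMap.mul k k).compl₁₂ (coeff ⟨v, v, Quiver.Path.nil⟩)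
        (coeff ⟨v, v, Quiver.Path.nil⟩) := by
    refine hom_ext fun p => hom_ext fun q => ?_
    simp only [LinearMap.compr₂_apply, LinearMap.compl₁₂_apply, LinearMap.mul_apply',
      mulLin_ofPath]
    obtain ⟨a, b, p⟩ := p
    obtain ⟨c, d, q⟩ := q
    by_cases h : c = b
    · subst h
      rw [pathMul_comp]
      cases q with
      | cons q e =>
        rw [coeff_of_filt (n := 1) (Submodule.subset_span ⟨_, by simp, rfl⟩) (by simp),
          coeff_of_filt (n := 1) (x := ofPath k ⟨c, d, q.cons e⟩)
            (Submodule.subset_span ⟨_, by simp, rfl⟩) (by simp), mul_zero]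
      | nil =>
        cases p with
        | cons p e =>
          rw [coeff_of_filt (n := 1) (Submodule.subset_span ⟨_, by simp, rfl⟩) (by simp),
            coeff_of_filt (n := 1) (x := ofPath k ⟨a, c, p.cons e⟩)
              (Submodule.subset_span ⟨_, by simp, rfl⟩) (by simp), zero_mul]
        | nil =>
          rw [Quiver.Path.comp_nil]
          by_cases hv : v = a
          · subst hv
            rw [coeff_self, mul_one]
          · rw [coeff_ne, mul_zero]
            intro h
            exact hv (congrArg BPath.src h)
    · rw [pathMul_ne h, map_zero]
      by_cases h₁ : (⟨v, v, Quiver.Path.nil⟩ : BPath Q) = ⟨a, b, p⟩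
      · rw [coeff_ne (q := ⟨c, d, q⟩), mul_zero]
        intro h₂
        exact h ((congrArg BPath.src h₂).symm.trans (congrArg BPath.tgt h₁))
      · rw [coeff_ne h₁, zero_mul]
  exact congrArg (fun F => F x y) h

theorem coeff_nil_one (v : Q) : coeff ⟨v, v, Quiver.Path.nil⟩ (1 : PathAlgebra k Q) = 1 := by
  classical
  rw [one_def, map_sum, Finset.sum_eq_single v]
  · exact coeff_self _
  · intro b _ hb
    refine coeff_ne ?_
    intro h
    exact hb (congrArg BPath.src h).symm
  · simp

theorem coeff_nil_pow (v : Q) (x : PathAlgebra k Q) (n : ℕ) :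
    coeff ⟨v, v, Quiver.Path.nil⟩ (x ^ n) = coeff ⟨v, v, Quiver.Path.nil⟩ x ^ n := by
  induction n with
  | zero => simp [coeff_nil_one]
  | succ n ih => rw [pow_succ, pow_succ, coeff_nil_mul, ih]

theorem mem_of_pow_mem {x : PathAlgebra k Q} {n : ℕ} (h : x ^ n ∈ arrowIdeal k Q) :
    x ∈ arrowIdeal k Q := by
  refine filt_one_le (mem_filt_one fun v => ?_)
  have h1 : coeff ⟨v, v, Quiver.Path.nil⟩ (x ^ n) = 0 :=
    coeff_of_filt (n := 1) (arrowIdeal_le h) (by simp)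
  rw [coeff_nil_pow] at h1
  exact eq_zero_of_pow_eq_zero h1

end

end PathAlgebra

/-! ### The action of `Aut_k(kQ/I)` on `T_2 Q` -/

noncomputable section

open PathAlgebra

variable {k : Type u} {Q : Type v} [Field k] [Quiver.{w} Q] [Fintype Q]

namespace IsAdmissible

variable {I : Ideal (PathAlgebra k Q)} [I.IsTwoSided]

/-- The canonical projection `kQ/I → kQ/J(Q)^2 = T_2 Q`. -/
def proj (hI : IsAdmissible I) : (PathAlgebra k Q ⧸ I) →ₐ[k] TruncatedAlgebra k Q 2 :=
  Ideal.Quotient.factorₐ k hI.le_sq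

theorem proj_mk (hI : IsAdmissible I) (x : PathAlgebra k Q) :
    hI.proj (Ideal.Quotient.mk I x) = Ideal.Quotient.mk (arrowIdeal k Q ^ 2) x := rfl

/-- Automorphisms of `kQ/I` preserve `J(Q)/I`. -/
theorem exists_mem (hI : IsAdmissible I) (φ : (PathAlgebra k Q ⧸ I) ≃ₐ[k] (PathAlgebra k Q ⧸ I))
    {x : PathAlgebra k Q} (hx : x ∈ arrowIdeal k Q) :
    ∃ y ∈ arrowIdeal k Q, φ (Ideal.Quotient.mk I x) = Ideal.Quotient.mk I y := by
  obtain ⟨y, hy⟩ := Ideal.Quotient.mk_surjective (φ (Ideal.Quotient.mk I x))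
  obtain ⟨l, -, hl⟩ := hI.pow_le
  refine ⟨y, mem_of_pow_mem (n := l) ?_, hy.symm⟩
  have h0 : Ideal.Quotient.mk I (x ^ l) = 0 :=
    Ideal.Quotient.eq_zero_iff_mem.2 (hl (Ideal.pow_mem_pow hx l))
  have h1 : Ideal.Quotient.mk I (y ^ l) = 0 := by
    rw [map_pow, hy, ← map_pow, ← map_pow, h0, map_zero]
  have h2 := hI.le_sq (Ideal.Quotient.eq_zero_iff_mem.1 h1)
  rw [sq_eq] at h2
  exact Ideal.mul_le_left h2

/-- The endomorphism of `T_2 Q` induced by an automorphism of `kQ/I`. -/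
def inducedHom (hI : IsAdmissible I) (φ : (PathAlgebra k Q ⧸ I) ≃ₐ[k] (PathAlgebra k Q ⧸ I)) :
    TruncatedAlgebra k Q 2 →ₐ[k] TruncatedAlgebra k Q 2 :=
  Ideal.Quotient.liftₐ (arrowIdeal k Q ^ 2)
    (hI.proj.comp ((φ : _ →ₐ[k] _).comp (Ideal.Quotient.mkₐ k I))) (by
      have h : arrowIdeal k Q ^ 2 ≤ RingHom.ker
          (hI.proj.comp ((φ : _ →ₐ[k] _).comp (Ideal.Quotient.mkₐ k I))) := by
        refine sq_eq.le.trans (Ideal.mul_le.2 ?_)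
        intro r hr s hs
        obtain ⟨r', hr', er⟩ := hI.exists_mem φ hr
        obtain ⟨s', hs', es⟩ := hI.exists_mem φ hs
        rw [RingHom.mem_ker]
        change hI.proj (φ (Ideal.Quotient.mk I (r * s))) = 0
        rw [map_mul, map_mul, er, es, ← map_mul, proj_mk, Ideal.Quotient.eq_zero_iff_mem, sq_eq]
        exact Ideal.mul_mem_mul hr' hs'
      exact fun a ha => h ha)

theorem inducedHom_proj (hI : IsAdmissible I)
    (φ : (PathAlgebra k Q ⧸ I) ≃ₐ[k] (PathAlgebra k Q ⧸ I)) (b : PathAlgebra k Q ⧸ I) :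
    hI.inducedHom φ (hI.proj b) = hI.proj (φ b) := by
  obtain ⟨x, rfl⟩ := Ideal.Quotient.mk_surjective b
  rfl

theorem proj_surjective (hI : IsAdmissible I) : Function.Surjective hI.proj := by
  intro y
  obtain ⟨x, rfl⟩ := Ideal.Quotient.mk_surjective y
  exact ⟨Ideal.Quotient.mk I x, rfl⟩

/-- The homomorphism `Aut_k(kQ/I) → Aut_k(T_2 Q)`; the image of `φ` is the unique automorphism
`ψ` with `ψ (proj b) = proj (φ b)` for all `b`. -/
def induced (hI : IsAdmissible I) :
    ((PathAlgebra k Q ⧸ I) ≃ₐ[k] (PathAlgebra k Q ⧸ I)) →*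
      (TruncatedAlgebra k Q 2 ≃ₐ[k] TruncatedAlgebra k Q 2) where
  toFun φ := AlgEquiv.ofAlgHom (hI.inducedHom φ) (hI.inducedHom φ.symm)
    (by
      refine AlgHom.ext fun y => ?_
      obtain ⟨b, rfl⟩ := hI.proj_surjective y
      simp [inducedHom_proj])
    (by
      refine AlgHom.ext fun y => ?_
      obtain ⟨b, rfl⟩ := hI.proj_surjective y
      simp [inducedHom_proj])
  map_one' := by
    refine AlgEquiv.ext fun y => ?_
    obtain ⟨b, rfl⟩ := hI.proj_surjective y
    exact hI.inducedHom_proj 1 b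
  map_mul' φ ψ := by
    refine AlgEquiv.ext fun y => ?_
    obtain ⟨b, rfl⟩ := hI.proj_surjective y
    change hI.inducedHom (φ * ψ) (hI.proj b) = hI.inducedHom φ (hI.inducedHom ψ (hI.proj b))
    rw [inducedHom_proj, inducedHom_proj, inducedHom_proj]
    rfl

theorem induced_proj (hI : IsAdmissible I)
    (φ : (PathAlgebra k Q ⧸ I) ≃ₐ[k] (PathAlgebra k Q ⧸ I)) (b : PathAlgebra k Q ⧸ I) :
    hI.induced φ (hI.proj b) = hI.proj (φ b) := hI.inducedHom_proj φ b

end IsAdmissible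

/-! ### Varieties of subalgebras, `msa(Q)`, and Grassmannians -/

/-- The set of `m`-dimensional (unital) subalgebras of `B`. -/
def AlgGr (k : Type u) [Field k] (m : ℕ) (B : Type*) [Ring B] [Algebra k B] :=
  {A : Subalgebra k B // Module.finrank k A = m}

/-- The automorphism group of `B` acts on subalgebras by `φ • A = φ(A)`. -/
instance (m : ℕ) (B : Type*) [Ring B] [Algebra k B] : MulAction (B ≃ₐ[k] B) (AlgGr k m B) where
  smul φ A := ⟨A.1.map (φ : B →ₐ[k] B), 
    (LinearEquiv.finrank_eq
      (φ.toLinearEquiv.submoduleMap (Subalgebra.toSubmodule A.1))).symm.trans A.2⟩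
  one_smul _ := Subtype.ext (SetLike.coe_injective (Set.image_id _))
  mul_smul φ ψ _ := Subtype.ext (SetLike.coe_injective (Set.image_comp φ ψ _))

/-- `msa(Q)`: the subalgebras of codimension one of `T_2 Q`. -/
abbrev Msa (k : Type u) (Q : Type v) [Field k] [Quiver.{w} Q] [Fintype Q] :=
  AlgGr k (Module.finrank k (TruncatedAlgebra k Q 2) - 1) (TruncatedAlgebra k Q 2)

/-- The action of `Aut_k(kQ/I)` on `msa(Q)`, through `Aut_k(kQ/I) → Aut_k(T_2 Q)`. -/
@[reducible] def IsAdmissible.msaAction {I : Ideal (PathAlgebra k Q)} [I.IsTwoSided]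
    (hI : IsAdmissible I) :
    MulAction ((PathAlgebra k Q ⧸ I) ≃ₐ[k] (PathAlgebra k Q ⧸ I)) (Msa k Q) :=
  MulAction.compHom (Msa k Q) hI.induced

/-- The set of `Aut_k(kQ/I)`-orbits on `msa(Q)`. -/
def IsAdmissible.MsaOrbits {I : Ideal (PathAlgebra k Q)} [I.IsTwoSided] (hI : IsAdmissible I) :=
  letI := hI.msaAction
  MulAction.orbitRel.Quotient ((PathAlgebra k Q ⧸ I) ≃ₐ[k] (PathAlgebra k Q ⧸ I)) (Msa k Q)

/-- The Grassmannian of `m`-dimensional subspaces of `V`. -/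
def Gr (k : Type u) [Field k] (m : ℕ) (V : Type*) [AddCommGroup V] [Module k V] :=
  {W : Submodule k V // Module.finrank k W = m}

/-- `GL(V)` acts on subspaces by `g • W = g(W)`. -/
instance (m : ℕ) (V : Type*) [AddCommGroup V] [Module k V] :
    MulAction (V ≃ₗ[k] V) (Gr k m V) where
  smul g W := ⟨W.1.map (g : V →ₗ[k] V), 
    (LinearEquiv.finrank_eq (g.submoduleMap W.1)).symm.trans W.2⟩
  one_smul _ := Subtype.ext (SetLike.coe_injective (Set.image_id _))
  mul_smul g h _ := Subtype.ext (SetLike.coe_injective (Set.image_comp g h _))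

/-! ### The groups `H_B` and `H_B(u,v)` -/

/-- The group `H_B`, `B = kQ/I`, of the automorphisms of `B` that fix every vertex. -/
def vertexFixing (I : Ideal (PathAlgebra k Q)) [I.IsTwoSided] :
    Subgroup ((PathAlgebra k Q ⧸ I) ≃ₐ[k] (PathAlgebra k Q ⧸ I)) where
  carrier := {φ | ∀ v : Q, φ (Ideal.Quotient.mk I (vertex k v)) = Ideal.Quotient.mk I (vertex k v)}
  one_mem' := fun _ => rfl
  mul_mem' := fun {φ ψ} hφ hψ v => by rw [AlgEquiv.mul_apply, hψ v, hφ v]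
  inv_mem' := fun {φ} hφ v => by
    change φ.symm _ = _
    rw [AlgEquiv.symm_apply_eq, hφ v]

/-- `u kQ₁ v`: the span in `kQ` of the arrows from `u` to `v`. -/
def arrowSpan (k : Type u) {Q : Type v} [Field k] [Quiver.{w} Q] (u v : Q) :
    Submodule k (PathAlgebra k Q) :=
  Submodule.span k (Set.range fun a : u ⟶ v => arrow k a)

/-- The canonical map `u kQ₁ v → T_2 Q`. -/
def arrowSpanMap (k : Type u) {Q : Type v} [Field k] [Quiver.{w} Q] [Fintype Q] (u v : Q) :
    arrowSpan k u v →ₗ[k] TruncatedAlgebra k Q 2 :=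
  (Ideal.Quotient.mkₐ k (arrowIdeal k Q ^ 2)).toLinearMap ∘ₗ (arrowSpan k u v).subtype

theorem arrowSpanMap_apply (u v : Q) (x : arrowSpan k u v) :
    arrowSpanMap k u v x = Ideal.Quotient.mk (arrowIdeal k Q ^ 2) x.1 := rfl

theorem arrowSpanMap_injective (u v : Q) : Function.Injective (arrowSpanMap k u v) := by
  rw [injective_iff_map_eq_zero]
  rintro ⟨x, hx⟩ h
  rw [arrowSpanMap_apply, Ideal.Quotient.eq_zero_iff_mem] at h
  refine Subtype.ext (ext_coeff fun p => ?_)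
  change coeff p x = coeff p 0
  rw [map_zero]
  rcases lt_or_ge p.path.length 2 with hp | hp
  · exact coeff_of_filt (sq_le h) hp
  · have : arrowSpan k u v ≤ LinearMap.ker (coeff (k := k) p) := by
      refine Submodule.span_le.2 ?_
      rintro _ ⟨a, rfl⟩
      refine coeff_ne ?_
      rintro rfl
      simp [Quiver.Hom.toPath] at hp
    exact this hx

theorem vertex_mul_arrow {u v : Q} (a : u ⟶ v) : vertex k u * arrow k a = arrow k a := by
  rw [vertex, arrow, ofPath_mul, pathMul_comp, Quiver.Path.nil_comp]

theorem arrow_mul_vertex {u v : Q} (a : u ⟶ v) : arrow k a * vertex k v = arrow k a := by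
  rw [vertex, arrow, ofPath_mul, pathMul_comp, Quiver.Path.comp_nil]

theorem arrowSpan_le (u v : Q) {x : PathAlgebra k Q} (hx : x ∈ arrowSpan k u v) :
    x ∈ arrowIdeal k Q ∧ vertex k u * x * vertex k v = x := by
  induction hx using Submodule.span_induction with
  | mem x h =>
    obtain ⟨a, rfl⟩ := h
    exact ⟨arrow_mem a, by simp only [vertex_mul_arrow, arrow_mul_vertex]⟩
  | zero => simp
  | add x y _ _ hx hy => exact ⟨Ideal.add_mem _ hx.1 hy.1, by rw [mul_add, add_mul, hx.2, hy.2]⟩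
  | smul c x _ hx =>
    exact ⟨Submodule.smul_of_tower_mem _ c hx.1, by
      rw [mul_smul_comm, smul_mul_assoc, hx.2]⟩

theorem corner_mem (u v : Q) {x : PathAlgebra k Q} (hx : x ∈ arrowIdeal k Q) :
    Ideal.Quotient.mk (arrowIdeal k Q ^ 2) (vertex k u * x * vertex k v) ∈
      LinearMap.range (arrowSpanMap k u v) := by
  have hx' : x ∈ filt k Q 1 := arrowIdeal_le hx
  clear hx
  unfold filt at hx'
  induction hx' using Submodule.span_induction with
  | mem x h =>
    obtain ⟨p, hp, rfl⟩ := h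
    rcases lt_or_ge p.path.length 2 with h2 | h2
    · obtain ⟨a, b, p⟩ := p
      have hl : p.length = 1 := by
        simp only [Set.mem_ofPred_eq] at hp h2
        omega
      cases p with
      | nil => simp at hl
      | @cons c _ p e =>
        cases p with
        | cons p e' => simp at hl
        | nil =>
          change Ideal.Quotient.mk _ (vertex k u * arrow k e * vertex k v) ∈ _
          by_cases ha : a = u
          · subst ha
            rw [vertex_mul_arrow]
            by_cases hb : v = b
            · subst hb
              rw [arrow_mul_vertex]
              exact ⟨⟨arrow k e, Submodule.subset_span ⟨e, rfl⟩⟩, rfl⟩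
            · rw [arrow, vertex, ofPath_mul, pathMul_ne hb, map_zero]
              exact Submodule.zero_mem _
          · rw [arrow, vertex, ofPath_mul, pathMul_ne ha, zero_mul, map_zero]
            exact Submodule.zero_mem _
    · rw [Ideal.Quotient.eq_zero_iff_mem.2]
      · exact Submodule.zero_mem _
      · exact Ideal.mul_mem_right _ _ (Ideal.mul_mem_left _ _ (ofPath_mem_sq h2))
  | zero => simp
  | add x y _ _ hx hy =>
    rw [mul_add, add_mul, map_add]
    exact Submodule.add_mem _ hx hy
  | smul c x _ hx =>
    rw [mul_smul_comm, smul_mul_assoc]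
    exact Submodule.smul_mem _ c hx

namespace IsAdmissible

variable {I : Ideal (PathAlgebra k Q)} [I.IsTwoSided]

theorem induced_mem_range (hI : IsAdmissible I) (u v : Q) (φ : vertexFixing I)
    (x : arrowSpan k u v) :
    hI.induced φ.1 (arrowSpanMap k u v x) ∈ LinearMap.range (arrowSpanMap k u v) := by
  obtain ⟨x, hx⟩ := x
  obtain ⟨h1, h2⟩ := arrowSpan_le u v hx
  obtain ⟨y, hy, e⟩ := hI.exists_mem φ.1 h1
  have : hI.induced φ.1 (arrowSpanMap k u v ⟨x, hx⟩) =
      Ideal.Quotient.mk (arrowIdeal k Q ^ 2) (vertex k u * y * vertex k v) := by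
    rw [arrowSpanMap_apply, ← hI.proj_mk, ← hI.proj_mk, induced_proj]
    change hI.proj (φ.1 (Ideal.Quotient.mk I x)) = _
    conv_lhs => rw [← h2]
    simp only [map_mul]
    rw [φ.2 u, φ.2 v, e]
  rw [this]
  exact corner_mem u v hy

/-- The endomorphism of `u kQ₁ v` induced by an element of `H_B`. -/
def piLin (hI : IsAdmissible I) (u v : Q) (φ : vertexFixing I) :
    arrowSpan k u v →ₗ[k] arrowSpan k u v :=
  (LinearEquiv.ofInjective _ (arrowSpanMap_injective u v)).symm.toLinearMap ∘ₗ
    LinearMap.codRestrict (LinearMap.range (arrowSpanMap k u v))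
      ((hI.induced φ.1).toLinearMap ∘ₗ arrowSpanMap k u v) (hI.induced_mem_range u v φ)

theorem arrowSpanMap_piLin (hI : IsAdmissible I) (u v : Q) (φ : vertexFixing I)
    (x : arrowSpan k u v) :
    arrowSpanMap k u v (hI.piLin u v φ x) = hI.induced φ.1 (arrowSpanMap k u v x) := by
  have := LinearEquiv.apply_symm_apply
    (LinearEquiv.ofInjective _ (arrowSpanMap_injective (k := k) u v))
    ⟨hI.induced φ.1 (arrowSpanMap k u v x), hI.induced_mem_range u v φ x⟩
  exact congrArg Subtype.val this

theorem piLin_one (hI : IsAdmissible I) (u v : Q) : hI.piLin u v 1 = LinearMap.id := by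
  refine LinearMap.ext fun x => arrowSpanMap_injective u v ?_
  rw [arrowSpanMap_piLin, OneMemClass.coe_one, map_one]
  rfl

theorem piLin_mul (hI : IsAdmissible I) (u v : Q) (φ ψ : vertexFixing I) :
    hI.piLin u v (φ * ψ) = hI.piLin u v φ ∘ₗ hI.piLin u v ψ := by
  refine LinearMap.ext fun x => arrowSpanMap_injective u v ?_
  rw [LinearMap.comp_apply, arrowSpanMap_piLin, arrowSpanMap_piLin, arrowSpanMap_piLin,
    MulMemClass.coe_mul, map_mul]
  rfl

/-- The homomorphism `π_{uv} : H_B → GL(u kQ₁ v)`: the image of `φ` is the restriction to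
`u kQ₁ v` of the automorphism of `T_2 Q` that `φ` induces. -/
def piHom (hI : IsAdmissible I) (u v : Q) :
    vertexFixing I →* (arrowSpan k u v ≃ₗ[k] arrowSpan k u v) where
  toFun φ := LinearEquiv.ofLinearMap (hI.piLin u v φ) (hI.piLin u v φ⁻¹)
    (by rw [← piLin_mul, mul_inv_cancel, piLin_one])
    (by rw [← piLin_mul, inv_mul_cancel, piLin_one])
  map_one' := LinearEquiv.toLinearMap_injective (hI.piLin_one u v)
  map_mul' φ ψ := LinearEquiv.toLinearMap_injective (hI.piLin_mul u v φ ψ)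

/-- The group `H_B(u,v)`: the image of `H_B` in `GL(u kQ₁ v)`. -/
def imageGroup (hI : IsAdmissible I) (u v : Q) :
    Subgroup (arrowSpan k u v ≃ₗ[k] arrowSpan k u v) :=
  (hI.piHom u v).range

end IsAdmissible

end

/-! The radical of `T_2 Q` is spanned by the arrows and squares to zero, so `T_2 Q` is determined by
the characters `eps x` and the arrow spaces. A hyperplane `W` of an arrow space gives a
codimension-one subalgebra `splitSubalgebra W`, and the theorem compares orbits of hyperplanes with
orbits of these subalgebras.

From subalgebras to hyperplanes, the obstacle is that an automorphism of `B` may permute the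
vertices and move them by radical elements. Modulo the radical only finitely many vertex
permutations occur, so they can be recorded as extra finite data. An automorphism `θ` that fixes the
vertices modulo the radical becomes an element of `H_B` after an inner correction by a unit in `1 +
rad B`, which does not change its effect on the arrows of `T_2 Q` (`exists_vertexFixing`). Hence an
orbit in `msa(Q)` meets only finitely many orbits of hyperplanes.

Conversely, write a codimension-one subalgebra as `ker f`. If `f` kills all arrows, the subalgebra
is the locus `eps x = eps y` for two vertices (`exists_mem_iff_eps_eq`), and there are finitely many
of these. If `f` is nonzero on an arrow `a : u ⟶ v`, multiplicative closure makes `f` vanish on all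
arrows not parallel to `a` and on all vertices except `u` and `v`. Conjugation by some `1 + c • a`
then makes it vanish on the vertices too, so the subalgebra is conjugate to a split one
(`exists_apply_induced`). -/

noncomputable section

open PathAlgebra

/-! ### Structure of `T_2 Q`: vertices, arrows, characters and arrow projections -/

namespace TruncatedAlgebra

variable {k : Type u} {Q : Type v} [Field k] [Quiver.{w} Q] [Fintype Q]

/-- The class of a vertex in `T_2 Q`. -/
def vert (k : Type u) {Q : Type v} [Field k] [Quiver.{w} Q] [Fintype Q] (x : Q) :
    TruncatedAlgebra k Q 2 := Ideal.Quotient.mk _ (vertex k x)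

/-- The class of an arrow in `T_2 Q`. -/
def arr (k : Type u) {Q : Type v} [Field k] [Quiver.{w} Q] [Fintype Q] {x y : Q} (a : x ⟶ y) :
    TruncatedAlgebra k Q 2 := Ideal.Quotient.mk _ (arrow k a)

theorem span_vert_arr : Submodule.span k (Set.range (vert k (Q := Q)) ∪
    Set.range (fun p : Σ x y : Q, (x ⟶ y) => arr k p.2.2)) = ⊤ := by
  rw [eq_top_iff]
  rintro t -
  obtain ⟨x, rfl⟩ := Ideal.Quotient.mk_surjective t
  have hx : x ∈ Submodule.span k (Set.range (ofPath (Q := Q) k)) := by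
    rw [span_ofPath]; trivial
  induction hx using Submodule.span_induction with
  | mem x h =>
    obtain ⟨⟨a, b, p⟩, rfl⟩ := h
    cases p with
    | nil => exact Submodule.subset_span (Or.inl ⟨a, rfl⟩)
    | cons p e =>
      cases p with
      | nil => exact Submodule.subset_span (Or.inr ⟨⟨_, _, e⟩, rfl⟩)
      | cons p e' =>
        rw [Ideal.Quotient.eq_zero_iff_mem.2 (ofPath_mem_sq (by simp))]
        exact Submodule.zero_mem _
  | zero => rw [map_zero]; exact Submodule.zero_mem _
  | add x y _ _ hx hy => rw [map_add]; exact Submodule.add_mem _ hx hy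
  | smul c x _ hx => exact Submodule.smul_mem _ c hx

theorem lin_ext {M : Type*} [AddCommGroup M] [Module k M] {f g : TruncatedAlgebra k Q 2 →ₗ[k] M}
    (hv : ∀ x, f (vert k x) = g (vert k x))
    (ha : ∀ (x y : Q) (a : x ⟶ y), f (arr k a) = g (arr k a)) : f = g := by
  refine LinearMap.ext_on span_vert_arr ?_
  rintro _ (⟨x, rfl⟩ | ⟨⟨x, y, a⟩, rfl⟩)
  · exact hv x
  · exact ha x y a

instance [∀ x y : Q, Finite (x ⟶ y)] : Module.Finite k (TruncatedAlgebra k Q 2) :=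
  ⟨⟨((Set.finite_range _).union (Set.finite_range _)).toFinset, by
    rw [Set.Finite.coe_toFinset]; exact span_vert_arr⟩⟩

theorem apply_eq_of_mk_eq {M : Type*} [AddCommGroup M] [Module k M] {f : PathAlgebra k Q →ₗ[k] M}
    (hf : ∀ p : BPath Q, 2 ≤ p.path.length → f (ofPath k p) = 0) {x y : PathAlgebra k Q}
    (h : Ideal.Quotient.mk (arrowIdeal k Q ^ 2) x = Ideal.Quotient.mk (arrowIdeal k Q ^ 2) y) :
    f x = f y := by
  have h2 : filt k Q 2 ≤ LinearMap.ker f := by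
    refine Submodule.span_le.2 ?_
    rintro _ ⟨p, hp, rfl⟩
    exact hf p hp
  have h3 : f (x - y) = 0 := h2 (sq_le (Ideal.Quotient.eq.1 h))
  rwa [map_sub, sub_eq_zero] at h3

theorem mk_surjInv (t : TruncatedAlgebra k Q 2) : Ideal.Quotient.mk (arrowIdeal k Q ^ 2)
    (Function.surjInv Ideal.Quotient.mk_surjective t) = t :=
  Function.surjInv_eq Ideal.Quotient.mk_surjective t

/-- A linear map on `kQ` that vanishes on paths of length at least two descends to `T_2 Q`. -/
def lift {M : Type*} [AddCommGroup M] [Module k M] (f : PathAlgebra k Q →ₗ[k] M)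
    (hf : ∀ p : BPath Q, 2 ≤ p.path.length → f (ofPath k p) = 0) :
    TruncatedAlgebra k Q 2 →ₗ[k] M where
  toFun t := f (Function.surjInv Ideal.Quotient.mk_surjective t)
  map_add' s t := by
    rw [← map_add]
    refine apply_eq_of_mk_eq hf ?_
    rw [map_add, mk_surjInv, mk_surjInv, mk_surjInv]
  map_smul' c t := by
    rw [RingHom.id_apply, ← map_smul]
    refine apply_eq_of_mk_eq hf ?_
    rw [mk_surjInv]
    change _ = c • Ideal.Quotient.mk _ _
    rw [mk_surjInv]

theorem lift_mk {M : Type*} [AddCommGroup M] [Module k M] (f : PathAlgebra k Q →ₗ[k] M)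
    (hf : ∀ p : BPath Q, 2 ≤ p.path.length → f (ofPath k p) = 0) (x : PathAlgebra k Q) :
    lift f hf (Ideal.Quotient.mk _ x) = f x :=
  apply_eq_of_mk_eq hf (Function.surjInv_eq _ _)

/-- The coefficient at a vertex, as a functional on `T_2 Q`. -/
def eps (x : Q) : TruncatedAlgebra k Q 2 →ₗ[k] k :=
  lift (coeff ⟨x, x, Quiver.Path.nil⟩) (by
    intro p hp
    refine coeff_ne ?_
    rintro rfl
    simp at hp)

theorem eps_mk (x : Q) (z : PathAlgebra k Q) :
    eps x (Ideal.Quotient.mk (arrowIdeal k Q ^ 2) z) = coeff ⟨x, x, Quiver.Path.nil⟩ z :=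
  lift_mk _ _ z

theorem eps_mul (x : Q) (s t : TruncatedAlgebra k Q 2) : eps x (s * t) = eps x s * eps x t := by
  obtain ⟨s, rfl⟩ := Ideal.Quotient.mk_surjective s
  obtain ⟨t, rfl⟩ := Ideal.Quotient.mk_surjective t
  rw [← map_mul, eps_mk, eps_mk, eps_mk, coeff_nil_mul]

theorem eps_vert_self (x : Q) : eps x (vert k x) = 1 :=
  (eps_mk _ _).trans (coeff_self _)

theorem eps_vert_ne {x y : Q} (h : x ≠ y) : eps x (vert k y) = 0 :=
  (eps_mk _ _).trans (coeff_ne fun e => h (congrArg BPath.src e))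

theorem eps_arr (x : Q) {y z : Q} (a : y ⟶ z) : eps x (arr k a) = 0 :=
  (eps_mk _ _).trans (coeff_of_filt (n := 1) (arrowIdeal_le (arrow_mem a)) (by simp))

/-- Identifies the radical with the common kernel of the characters `eps x`. Below, "lies in the
radical" is always expressed by the vanishing of every `eps x`. -/
theorem mem_arrowIdeal_iff {z : PathAlgebra k Q} : z ∈ arrowIdeal k Q ↔
    ∀ x : Q, eps x (Ideal.Quotient.mk (arrowIdeal k Q ^ 2) z) = 0 :=
  ⟨fun h _ => (eps_mk _ _).trans (coeff_of_filt (n := 1) (arrowIdeal_le h) (by simp)),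
    fun h => filt_one_le (mem_filt_one fun x => (eps_mk x z).symm.trans (h x))⟩

theorem mul_eq_zero_of_eps {s t : TruncatedAlgebra k Q 2} (hs : ∀ x, eps x s = 0)
    (ht : ∀ x, eps x t = 0) : s * t = 0 := by
  obtain ⟨s, rfl⟩ := Ideal.Quotient.mk_surjective s
  obtain ⟨t, rfl⟩ := Ideal.Quotient.mk_surjective t
  rw [← map_mul, Ideal.Quotient.eq_zero_iff_mem, sq_eq]
  exact Ideal.mul_mem_mul (mem_arrowIdeal_iff.2 hs) (mem_arrowIdeal_iff.2 ht)

theorem arr_mul_arr {x y z t : Q} (a : x ⟶ y) (b : z ⟶ t) : arr k a * arr k b = 0 :=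
  mul_eq_zero_of_eps (fun _ => eps_arr _ a) (fun _ => eps_arr _ b)

theorem vert_mul_self (x : Q) : vert k x * vert k x = vert k x := by
  rw [vert, ← map_mul, vertex, ofPath_mul, pathMul_comp]; rfl

theorem vert_mul_ne {x y : Q} (h : x ≠ y) : vert k x * vert k y = 0 := by
  rw [vert, vert, ← map_mul, vertex, vertex, ofPath_mul, pathMul_ne h.symm, map_zero]

theorem vert_mul_arr {x y : Q} (a : x ⟶ y) : vert k x * arr k a = arr k a := by
  rw [vert, arr, ← map_mul, vertex_mul_arrow]

theorem arr_mul_vert {x y : Q} (a : x ⟶ y) : arr k a * vert k y = arr k a := by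
  rw [vert, arr, ← map_mul, arrow_mul_vertex]

theorem vert_mul_arr_ne {x y z : Q} (a : x ⟶ y) (h : z ≠ x) : vert k z * arr k a = 0 := by
  rw [← vert_mul_arr, ← mul_assoc, vert_mul_ne h, zero_mul]

theorem arr_mul_vert_ne {x y z : Q} (a : x ⟶ y) (h : z ≠ y) : arr k a * vert k z = 0 := by
  rw [← arr_mul_vert, mul_assoc, vert_mul_ne h.symm, mul_zero]

theorem sum_vert : ∑ x : Q, vert k x = 1 := by
  simp only [vert]
  rw [← map_sum, ← one_def, map_one]

open Classical in
/-- The projection of `kQ` onto `u kQ₁ v` along all other paths. -/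
def pathProj (k : Type u) {Q : Type v} [Field k] [Quiver.{w} Q] (x y : Q) :
    PathAlgebra k Q →ₗ[k] arrowSpan k x y :=
  (pathBasis k Q).constr k fun p =>
    if h : ∃ a : x ⟶ y, p = ⟨x, y, a.toPath⟩ then
      ⟨ofPath k p, Submodule.subset_span ⟨h.choose, congrArg (ofPath k) h.choose_spec.symm⟩⟩
    else 0

theorem pathProj_arrow {x y : Q} (a : x ⟶ y) :
    pathProj k x y (arrow k a) = ⟨arrow k a, Submodule.subset_span ⟨a, rfl⟩⟩ := by
  refine (Module.Basis.constr_basis _ _ _ _).trans ?_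
  rw [dif_pos ⟨a, rfl⟩]
  rfl

theorem pathProj_ofPath {x y : Q} {p : BPath Q} (h : ∀ a : x ⟶ y, p ≠ ⟨x, y, a.toPath⟩) :
    pathProj k x y (ofPath k p) = 0 := by
  rw [pathProj, ofPath, Module.Basis.constr_basis, dif_neg]
  rintro ⟨a, ha⟩
  exact h a ha

/-- The projection of `T_2 Q` onto `u kQ₁ v` along the vertices and the other arrows. -/
def arrowProj (k : Type u) {Q : Type v} [Field k] [Quiver.{w} Q] [Fintype Q] (x y : Q) :
    TruncatedAlgebra k Q 2 →ₗ[k] arrowSpan k x y :=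
  lift (pathProj k x y) (by
    intro p hp
    refine pathProj_ofPath ?_
    rintro a rfl
    simp [Quiver.Hom.toPath] at hp)

theorem arrowProj_arr {x y : Q} (a : x ⟶ y) :
    arrowProj k x y (arr k a) = ⟨arrow k a, Submodule.subset_span ⟨a, rfl⟩⟩ :=
  (lift_mk _ _ _).trans (pathProj_arrow a)

theorem arrowProj_vert (x y z : Q) : arrowProj k x y (vert k z) = 0 := by
  refine (lift_mk _ _ _).trans (pathProj_ofPath fun a h => ?_)
  have hl := congrArg (fun p : BPath Q => p.path.length) h
  simp [Quiver.Hom.toPath] at hl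

theorem arrowProj_arr_ne {x y z t : Q} (a : z ⟶ t) (h : ¬(z = x ∧ t = y)) :
    arrowProj k x y (arr k a) = 0 :=
  (lift_mk _ _ _).trans
    (pathProj_ofPath fun _ e => h ⟨congrArg BPath.src e, congrArg BPath.tgt e⟩)

theorem arrowSpan_ext {x y : Q} {M : Type*} [AddCommGroup M] [Module k M]
    {f g : arrowSpan k x y →ₗ[k] M}
    (h : ∀ a : x ⟶ y, f ⟨arrow k a, Submodule.subset_span ⟨a, rfl⟩⟩ =
      g ⟨arrow k a, Submodule.subset_span ⟨a, rfl⟩⟩) : f = g := by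
  refine LinearMap.ext fun ⟨z, hz⟩ => ?_
  induction hz using Submodule.span_induction with
  | mem z hz => obtain ⟨a, rfl⟩ := hz; exact h a
  | zero => exact (map_zero f).trans (map_zero g).symm
  | add z t hz ht h1 h2 =>
    exact (map_add f ⟨z, hz⟩ ⟨t, ht⟩).trans
      ((congrArg₂ (· + ·) h1 h2).trans (map_add g ⟨z, hz⟩ ⟨t, ht⟩).symm)
  | smul c z hz h1 =>
    exact (map_smul f c ⟨z, hz⟩).trans
      ((congrArg (c • ·) h1).trans (map_smul g c ⟨z, hz⟩).symm)

theorem arrowProj_arrowSpanMap {x y : Q} (z : arrowSpan k x y) :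
    arrowProj k x y (arrowSpanMap k x y z) = z := by
  have : arrowProj k x y ∘ₗ arrowSpanMap k x y = LinearMap.id :=
    arrowSpan_ext fun a => arrowProj_arr a
  exact congrArg (fun F => F z) this

theorem arrowProj_arrowSpanMap_ne {x y z t : Q} (h : ¬(z = x ∧ t = y)) (w : arrowSpan k z t) :
    arrowProj k x y (arrowSpanMap k z t w) = 0 := by
  have : arrowProj k x y ∘ₗ arrowSpanMap k z t = 0 :=
    arrowSpan_ext fun a => arrowProj_arr_ne a h
  exact congrArg (fun F => F w) this

theorem eps_arrowSpanMap (x : Q) {y z : Q} (w : arrowSpan k y z) :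
    eps x (arrowSpanMap k y z w) = 0 := by
  have : eps x ∘ₗ arrowSpanMap k y z = 0 := arrowSpan_ext fun a => eps_arr x a
  exact congrArg (fun F => F w) this

theorem arrowProj_surjective (x y : Q) : Function.Surjective (arrowProj k x y) :=
  fun z => ⟨_, arrowProj_arrowSpanMap z⟩

/-- A Leibniz rule twisted by two characters: products of arrows vanish, so an arrow component of `s
* t` takes a vertex coefficient from one factor. This is why the preimage of any subspace is closed
under multiplication. -/
theorem arrowProj_mul (x y : Q) (s t : TruncatedAlgebra k Q 2) :
    arrowProj k x y (s * t) = eps x s • arrowProj k x y t + eps y t • arrowProj k x y s := by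
  have h : (LinearMap.mul k (TruncatedAlgebra k Q 2)).compr₂ (arrowProj k x y) =
      (LinearMap.lsmul k (arrowSpan k x y)).compl₁₂ (eps x) (arrowProj k x y) +
      ((LinearMap.lsmul k (arrowSpan k x y)).compl₁₂ (eps y) (arrowProj k x y)).flip := by
    refine lin_ext (fun z => lin_ext (fun z' => ?_) fun p q a => ?_)
      fun p q a => lin_ext (fun z => ?_) fun p' q' a' => ?_
    · simp only [LinearMap.compr₂_apply, LinearMap.mul_apply', LinearMap.add_apply,
        LinearMap.compl₁₂_apply, LinearMap.lsmul_apply, LinearMap.flip_apply, arrowProj_vert,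
        smul_zero, add_zero]
      by_cases hz : z = z'
      · rw [hz, vert_mul_self, arrowProj_vert]
      · rw [vert_mul_ne hz, map_zero]
    · simp only [LinearMap.compr₂_apply, LinearMap.mul_apply', LinearMap.add_apply,
        LinearMap.compl₁₂_apply, LinearMap.lsmul_apply, LinearMap.flip_apply, arrowProj_vert,
        smul_zero, add_zero]
      by_cases hp : p = x ∧ q = y
      · obtain ⟨rfl, rfl⟩ := hp
        by_cases hz : z = p
        · rw [hz, vert_mul_arr, eps_vert_self, one_smul]
        · rw [vert_mul_arr_ne a hz, eps_vert_ne (Ne.symm hz), zero_smul, map_zero]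
      · rw [arrowProj_arr_ne a hp, smul_zero]
        by_cases hz : z = p
        · rw [hz, vert_mul_arr, arrowProj_arr_ne a hp]
        · rw [vert_mul_arr_ne a hz, map_zero]
    · simp only [LinearMap.compr₂_apply, LinearMap.mul_apply', LinearMap.add_apply,
        LinearMap.compl₁₂_apply, LinearMap.lsmul_apply, LinearMap.flip_apply, arrowProj_vert,
        smul_zero, zero_add]
      by_cases hp : p = x ∧ q = y
      · obtain ⟨rfl, rfl⟩ := hp
        by_cases hz : z = q
        · rw [hz, arr_mul_vert, eps_vert_self, one_smul]
        · rw [arr_mul_vert_ne a hz, eps_vert_ne (Ne.symm hz), zero_smul, map_zero]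
      · rw [arrowProj_arr_ne a hp, smul_zero]
        by_cases hz : z = q
        · rw [hz, arr_mul_vert, arrowProj_arr_ne a hp]
        · rw [arr_mul_vert_ne a hz, map_zero]
    · simp only [LinearMap.compr₂_apply, LinearMap.mul_apply', LinearMap.add_apply,
        LinearMap.compl₁₂_apply, LinearMap.flip_apply, arr_mul_arr,
        eps_arr, map_zero, LinearMap.zero_apply, add_zero]
  exact congrArg (fun F => F s t) h

/-! ### Split subalgebras attached to hyperplanes of arrow spaces -/

/-- The subalgebra of `T_2 Q` spanned by the vertices, a subspace `W` of `u kQ₁ v` and all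
arrows that do not go from `u` to `v`. -/
def splitSubalgebra {x y : Q} (W : Submodule k (arrowSpan k x y)) :
    Subalgebra k (TruncatedAlgebra k Q 2) :=
  (W.comap (arrowProj k x y)).toSubalgebra
    (by
      rw [Submodule.mem_comap, ← sum_vert, map_sum]
      exact Submodule.sum_mem _ fun z _ => by rw [arrowProj_vert]; exact W.zero_mem)
    (fun s t hs ht => by
      rw [Submodule.mem_comap] at hs ht ⊢
      rw [arrowProj_mul]
      exact W.add_mem (W.smul_mem _ ht) (W.smul_mem _ hs))

theorem mem_splitSubalgebra {x y : Q} {W : Submodule k (arrowSpan k x y)}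
    {t : TruncatedAlgebra k Q 2} : t ∈ splitSubalgebra W ↔ arrowProj k x y t ∈ W := Iff.rfl

theorem arrowSpanMap_mem_splitSubalgebra {x y : Q} {W : Submodule k (arrowSpan k x y)}
    {z : arrowSpan k x y} : arrowSpanMap k x y z ∈ splitSubalgebra W ↔ z ∈ W := by
  rw [mem_splitSubalgebra, arrowProj_arrowSpanMap]

variable [∀ x y : Q, Finite (x ⟶ y)]

instance (x y : Q) : Module.Finite k (arrowSpan k x y) :=
  Module.Finite.of_surjective _ (arrowProj_surjective x y)

theorem finrank_arrowSpan_pos {x y : Q} (h : Nonempty (x ⟶ y)) :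
    0 < Module.finrank k (arrowSpan k x y) := by
  obtain ⟨a⟩ := h
  rw [Module.finrank_pos_iff_exists_ne_zero]
  refine ⟨⟨arrow k a, Submodule.subset_span ⟨a, rfl⟩⟩, fun h0 => ?_⟩
  have h1 := coeff_self (k := k) (⟨x, y, a.toPath⟩ : BPath Q)
  rw [show ofPath k (⟨x, y, a.toPath⟩ : BPath Q) = 0 from congrArg Subtype.val h0, map_zero] at h1
  exact zero_ne_one h1

theorem finrank_splitSubalgebra {x y : Q} (h : Nonempty (x ⟶ y))
    (W : Gr k (Module.finrank k (arrowSpan k x y) - 1) (arrowSpan k x y)) :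
    Module.finrank k (splitSubalgebra W.1) =
      Module.finrank k (TruncatedAlgebra k Q 2) - 1 := by
  have h1 := LinearMap.finrank_range_add_finrank_ker (W.1.mkQ ∘ₗ arrowProj k x y)
  rw [LinearMap.range_eq_top.2
    (show Function.Surjective (W.1.mkQ ∘ₗ arrowProj k x y) from
      (Submodule.mkQ_surjective _).comp (arrowProj_surjective x y)),
    finrank_top, LinearMap.ker_comp, Submodule.ker_mkQ] at h1
  have h2 := W.1.finrank_quotient_add_finrank
  have h3 := W.2
  -- Without an arrow, the truncated `0 - 1 = 0` would make `W` the whole space and its preimage of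
  -- codimension zero.
  have h4 := finrank_arrowSpan_pos (k := k) h
  change Module.finrank k (W.1.comap (arrowProj k x y)) = _
  omega

/-- The point of `msa(Q)` given by a hyperplane of `u kQ₁ v`. -/
def splitMsa {x y : Q} (h : Nonempty (x ⟶ y))
    (W : Gr k (Module.finrank k (arrowSpan k x y) - 1) (arrowSpan k x y)) : Msa k Q :=
  ⟨splitSubalgebra W.1, finrank_splitSubalgebra h W⟩

end TruncatedAlgebra

/-! ### Automorphisms of `B` up to inner correction; from subalgebras to hyperplanes -/

open TruncatedAlgebra

/-- Conjugation by a unit of an algebra. -/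
def conjAut (k : Type*) {B : Type*} [CommSemiring k] [Ring B] [Algebra k B] (b : Bˣ) : B ≃ₐ[k] B :=
  MulSemiringAction.toAlgEquiv k B (ConjAct.toConjAct b)

theorem conjAut_apply {k B : Type*} [CommSemiring k] [Ring B] [Algebra k B] (b : Bˣ) (z : B) :
    conjAut k b z = b * z * ↑b⁻¹ := rfl

variable {k : Type u} {Q : Type v} [Field k] [Quiver.{w} Q] [Fintype Q]

namespace IsAdmissible

variable {I : Ideal (PathAlgebra k Q)} [I.IsTwoSided]

theorem proj_vertex (hI : IsAdmissible I) (x : Q) :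
    hI.proj (Ideal.Quotient.mk I (vertex k x)) = vert k x := rfl

theorem induced_vert (hI : IsAdmissible I) (ψ : vertexFixing I) (x : Q) :
    hI.induced ψ.1 (vert k x) = vert k x := by
  rw [← hI.proj_vertex, induced_proj, ψ.2 x]

theorem eps_proj_map (hI : IsAdmissible I) (φ : (PathAlgebra k Q ⧸ I) ≃ₐ[k] (PathAlgebra k Q ⧸ I))
    {z : PathAlgebra k Q ⧸ I} (hz : ∀ x, eps x (hI.proj z) = 0) (x : Q) :
    eps x (hI.proj (φ z)) = 0 := by
  obtain ⟨z, rfl⟩ := Ideal.Quotient.mk_surjective z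
  obtain ⟨y, hy, e⟩ := hI.exists_mem φ (mem_arrowIdeal_iff.2 hz)
  rw [e]
  exact mem_arrowIdeal_iff.1 hy x

theorem isNilpotent_of_eps (hI : IsAdmissible I) {z : PathAlgebra k Q ⧸ I}
    (hz : ∀ x, eps x (hI.proj z) = 0) : IsNilpotent z := by
  obtain ⟨z, rfl⟩ := Ideal.Quotient.mk_surjective z
  obtain ⟨l, -, hl⟩ := hI.pow_le
  exact ⟨l, by
    rw [← map_pow]
    exact Ideal.Quotient.eq_zero_iff_mem.2
      (hl (Ideal.pow_mem_pow (mem_arrowIdeal_iff.2 hz) l))⟩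

theorem sum_mk_vertex : ∑ x : Q, Ideal.Quotient.mk I (vertex k x) = 1 := by
  rw [← map_sum, ← one_def, map_one]

theorem mk_vertex_mul_self (x : Q) : Ideal.Quotient.mk I (vertex k x) *
    Ideal.Quotient.mk I (vertex k x) = Ideal.Quotient.mk I (vertex k x) := by
  rw [← map_mul, vertex, ofPath_mul, pathMul_comp]; rfl

theorem mk_vertex_mul_ne {x y : Q} (h : x ≠ y) : Ideal.Quotient.mk I (vertex k x) *
    Ideal.Quotient.mk I (vertex k y) = 0 := by
  rw [← map_mul, vertex, vertex, ofPath_mul, pathMul_ne h.symm, map_zero]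

/-- An automorphism of `B` that fixes the vertices modulo the radical agrees on the radical of
`T_2 Q` with one that fixes the vertices. -/
theorem exists_vertexFixing (hI : IsAdmissible I)
    (θ : (PathAlgebra k Q ⧸ I) ≃ₐ[k] (PathAlgebra k Q ⧸ I))
    (h : ∀ x y, eps y (hI.proj (θ (Ideal.Quotient.mk I (vertex k x)))) = eps y (vert k x)) :
    ∃ ψ : vertexFixing I, ∀ t : TruncatedAlgebra k Q 2, (∀ x, eps x t = 0) →
      hI.induced ψ.1 t = hI.induced θ t := by
  classical
  set e : Q → PathAlgebra k Q ⧸ I := fun x => Ideal.Quotient.mk I (vertex k x) with he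
  -- The standard intertwiner of two complete systems of orthogonal idempotents: `θ (e x) * c = c *
  -- e x`. It is congruent to `1` modulo the nilpotent radical, hence a unit.
  set c : PathAlgebra k Q ⧸ I := ∑ x, θ (e x) * e x with hc
  have hce (x : Q) : c * e x = θ (e x) * e x := by
    rw [hc, Finset.sum_mul, Finset.sum_eq_single x]
    · rw [mul_assoc]; exact congrArg _ (mk_vertex_mul_self x)
    · intro y _ hy
      rw [mul_assoc, show e y * e x = 0 from mk_vertex_mul_ne hy, mul_zero]
    · simp
  have hec (x : Q) : θ (e x) * c = θ (e x) * e x := by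
    rw [hc, Finset.mul_sum, Finset.sum_eq_single x]
    · rw [← mul_assoc, ← map_mul, show e x * e x = e x from mk_vertex_mul_self x]
    · intro y _ hy
      rw [← mul_assoc, ← map_mul, show e x * e y = 0 from mk_vertex_mul_ne hy.symm, map_zero,
        zero_mul]
    · simp
  have heps (y : Q) : eps y (hI.proj (1 - c)) = 0 := by
    rw [← sum_mk_vertex, hc, ← Finset.sum_sub_distrib, map_sum, map_sum]
    refine Finset.sum_eq_zero fun x _ => ?_
    rw [map_sub, map_mul, map_sub, eps_mul, h, hI.proj_vertex, ← eps_mul, vert_mul_self, sub_self]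
  have hunit : IsUnit c := by
    have := (hI.isNilpotent_of_eps heps).isUnit_one_sub
    rwa [sub_sub_cancel] at this
  obtain ⟨b, hb⟩ := hunit
  refine ⟨⟨conjAut k b⁻¹ * θ, fun x => ?_⟩, fun t ht => ?_⟩
  · rw [AlgEquiv.mul_apply, conjAut_apply, inv_inv, mul_assoc]
    change _ * (θ (e x) * _) = e x
    rw [hb, hec, ← hce, ← mul_assoc, ← hb, Units.inv_mul, one_mul]
  -- The image of `c` in `T_2 Q` differs from `1` by a radical element, which annihilates the
  -- radical on both sides; so conjugating by `c` does nothing there.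
  · obtain ⟨z, rfl⟩ := hI.proj_surjective t
    rw [induced_proj, induced_proj, AlgEquiv.mul_apply, conjAut_apply, inv_inv, map_mul, map_mul]
    have hθ := hI.eps_proj_map θ ht
    have h1 : hI.proj (1 - c) * hI.proj (θ z) = 0 := mul_eq_zero_of_eps heps hθ
    have h2 : hI.proj (θ z) * hI.proj (1 - c) = 0 := mul_eq_zero_of_eps hθ heps
    rw [map_sub, map_one, sub_mul, one_mul, sub_eq_zero] at h1
    rw [map_sub, map_one, mul_sub, mul_one, sub_eq_zero] at h2
    rw [mul_assoc, hb, ← h2]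
    conv_lhs => rw [h1]
    rw [← mul_assoc, ← map_mul, ← hb, Units.inv_mul, map_one, one_mul]

/-- An element of `H_B` respects the decomposition of `T_2 Q` into vertices and arrow spaces, so it
commutes with the projections. -/
theorem arrowProj_induced (hI : IsAdmissible I) (x y : Q) (ψ : vertexFixing I)
    (t : TruncatedAlgebra k Q 2) :
    arrowProj k x y (hI.induced ψ.1 t) = hI.piLin x y ψ (arrowProj k x y t) := by
  have : arrowProj k x y ∘ₗ (hI.induced ψ.1).toLinearMap =
      hI.piLin x y ψ ∘ₗ arrowProj k x y := by
    refine lin_ext (fun z => ?_) fun p q a => ?_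
    · change arrowProj k x y (hI.induced ψ.1 (vert k z)) = hI.piLin x y ψ (arrowProj k x y _)
      rw [induced_vert, arrowProj_vert, map_zero]
    · change arrowProj k x y (hI.induced ψ.1 (arr k a)) = hI.piLin x y ψ (arrowProj k x y _)
      have ha : arr k a = arrowSpanMap k p q ⟨arrow k a, Submodule.subset_span ⟨a, rfl⟩⟩ := rfl
      rw [ha, ← arrowSpanMap_piLin]
      by_cases hp : p = x ∧ q = y
      · obtain ⟨rfl, rfl⟩ := hp
        rw [arrowProj_arrowSpanMap, arrowProj_arrowSpanMap]
      · rw [arrowProj_arrowSpanMap_ne hp, arrowProj_arrowSpanMap_ne hp, map_zero]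
  exact congrArg (fun F => F t) this

variable [∀ x y : Q, Finite (x ⟶ y)]

theorem induced_smul_splitMsa (hI : IsAdmissible I) {x y : Q} (h : Nonempty (x ⟶ y))
    (ψ : vertexFixing I)
    (W : Gr k (Module.finrank k (arrowSpan k x y) - 1) (arrowSpan k x y)) :
    hI.induced ψ.1 • splitMsa h W = splitMsa h (hI.piHom x y ψ • W) := by
  refine Subtype.ext (Subalgebra.ext fun t => ?_)
  constructor
  · rintro ⟨s, hs, rfl⟩
    change arrowProj k x y (hI.induced ψ.1 s) ∈ (hI.piHom x y ψ • W).1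
    rw [arrowProj_induced]
    exact ⟨_, hs, rfl⟩
  · rintro ⟨w, hw, e⟩
    refine ⟨(hI.induced ψ.1).symm t, ?_, (hI.induced ψ.1).apply_symm_apply t⟩
    change arrowProj k x y _ ∈ W.1
    suffices arrowProj k x y ((hI.induced ψ.1).symm t) = w by rw [this]; exact hw
    refine (hI.piHom x y ψ).injective (Eq.trans ?_ e.symm)
    change hI.piLin x y ψ _ = _
    rw [← arrowProj_induced, AlgEquiv.apply_symm_apply]

/-- `W` is recovered from its split subalgebra by intersecting with the arrow space. That space lies
in the radical, where `θ` and `ψ` agree; equal dimensions turn the inclusion into an equality. -/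
theorem piHom_smul_eq_of_induced_smul (hI : IsAdmissible I) {x y : Q} (h : Nonempty (x ⟶ y))
    (θ : (PathAlgebra k Q ⧸ I) ≃ₐ[k] (PathAlgebra k Q ⧸ I)) (ψ : vertexFixing I)
    (hψ : ∀ t : TruncatedAlgebra k Q 2, (∀ x, eps x t = 0) → hI.induced ψ.1 t = hI.induced θ t)
    {W W' : Gr k (Module.finrank k (arrowSpan k x y) - 1) (arrowSpan k x y)}
    (hW : hI.induced θ • splitMsa h W = splitMsa h W') : hI.piHom x y ψ • W = W' := by
  refine Subtype.ext (Submodule.eq_of_le_of_finrank_eq ?_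
    ((hI.piHom x y ψ • W).2.trans W'.2.symm))
  rintro _ ⟨z, hz, rfl⟩
  change hI.piLin x y ψ z ∈ W'.1
  rw [← arrowSpanMap_mem_splitSubalgebra, arrowSpanMap_piLin, hψ _ fun x => eps_arrowSpanMap x z]
  change _ ∈ (splitMsa h W').1
  rw [← hW]
  exact ⟨_, arrowSpanMap_mem_splitSubalgebra.2 hz, rfl⟩

theorem finite_grassmannian_orbits (hI : IsAdmissible I) (hfin : Finite hI.MsaOrbits) {x y : Q}
    (h : Nonempty (x ⟶ y)) : Finite (MulAction.orbitRel.Quotient (hI.imageGroup x y)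
      (Gr k (Module.finrank k (arrowSpan k x y) - 1) (arrowSpan k x y))) := by
  let _ := hI.msaAction
  have _ : Finite (MulAction.orbitRel.Quotient ((PathAlgebra k Q ⧸ I) ≃ₐ[k] (PathAlgebra k Q ⧸ I))
    (Msa k Q)) := hfin
  let orb : Msa k Q → MulAction.orbitRel.Quotient
    ((PathAlgebra k Q ⧸ I) ≃ₐ[k] (PathAlgebra k Q ⧸ I)) (Msa k Q) := Quotient.mk _
  have hφ (A : Msa k Q) : ∃ φ : (PathAlgebra k Q ⧸ I) ≃ₐ[k] (PathAlgebra k Q ⧸ I),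
      hI.induced φ • A = (orb A).out := by
    obtain ⟨φ, hφ⟩ := (MulAction.orbitRel_apply
      (G := (PathAlgebra k Q ⧸ I) ≃ₐ[k] (PathAlgebra k Q ⧸ I))).1 (Quotient.mk_out A)
    exact ⟨φ, hφ⟩
  choose φ hφ using hφ
  -- An orbit of hyperplanes is sent to the orbit of its split subalgebra, together with the action
  -- on vertices modulo the radical of a chosen automorphism `φ` carrying that subalgebra to the
  -- orbit representative. The target is finite.
  let F (q : MulAction.orbitRel.Quotient (hI.imageGroup x y)
      (Gr k (Module.finrank k (arrowSpan k x y) - 1) (arrowSpan k x y))) :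
      MulAction.orbitRel.Quotient ((PathAlgebra k Q ⧸ I) ≃ₐ[k] (PathAlgebra k Q ⧸ I)) (Msa k Q) ×
      (Q → Q → Prop) :=
    (orb (splitMsa h q.out), fun a b =>
      eps b (hI.proj (φ (splitMsa h q.out) (Ideal.Quotient.mk I (vertex k a)))) = 1)
  refine Finite.of_injective F fun q q' hq => ?_
  have h1 := congrArg Prod.fst hq
  have h2 := congrArg Prod.snd hq
  simp only [F] at h1 h2
  set A := splitMsa h q.out with hA
  set A' := splitMsa h q'.out with hA'
  have h3 (a b : Q) : eps b (hI.proj (φ A (Ideal.Quotient.mk I (vertex k a)))) =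
      eps b (hI.proj (φ A' (Ideal.Quotient.mk I (vertex k a)))) := by
    -- A character takes an idempotent to `0` or `1`, so knowing whether the value is `1` determines
    -- it.
    have key (σ : (PathAlgebra k Q ⧸ I) ≃ₐ[k] (PathAlgebra k Q ⧸ I)) :
        eps b (hI.proj (σ (Ideal.Quotient.mk I (vertex k a)))) = 0 ∨
        eps b (hI.proj (σ (Ideal.Quotient.mk I (vertex k a)))) = 1 := by
      refine IsIdempotentElem.iff_eq_zero_or_one.1 ?_
      rw [IsIdempotentElem, ← eps_mul, ← map_mul, ← map_mul, mk_vertex_mul_self]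
    have h4 := congrFun (congrFun h2 a) b
    rcases key (φ A) with h5 | h5 <;> rcases key (φ A') with h6 | h6
    · rw [h5, h6]
    · exact absurd (h5.symm.trans (h4.mpr h6)) zero_ne_one
    · exact absurd (h6.symm.trans (h4.mp h5)) zero_ne_one
    · rw [h5, h6]
  -- By `h3` the two automorphisms agree on vertices modulo the radical, and `(φ A')⁻¹` preserves
  -- the radical.
  obtain ⟨ψ, hψ⟩ := hI.exists_vertexFixing ((φ A')⁻¹ * φ A) (by
    intro a b
    have h4 := hI.eps_proj_map (φ A')⁻¹ (z := φ A (Ideal.Quotient.mk I (vertex k a)) -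
      φ A' (Ideal.Quotient.mk I (vertex k a))) (fun c => by
        rw [map_sub, map_sub, h3, sub_self]) b
    rw [map_sub, map_sub, map_sub, sub_eq_zero] at h4
    rw [AlgEquiv.mul_apply, h4, ← AlgEquiv.mul_apply, inv_mul_cancel, AlgEquiv.one_apply,
      hI.proj_vertex])
  have h5 := hI.piHom_smul_eq_of_induced_smul h _ ψ hψ (W := q.out) (W' := q'.out) (by
    rw [map_mul, mul_smul, ← hA, hφ, h1, ← hφ A', ← mul_smul, map_inv, inv_mul_cancel, one_smul])
  rw [← q.out_eq, ← q'.out_eq]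
  refine (Quotient.sound ?_).symm
  exact MulAction.orbitRel_apply.2 ⟨⟨hI.piHom x y ψ, ψ, rfl⟩, h5⟩

end IsAdmissible

/-! ### Classification of the codimension-one subalgebras of `T_2 Q` -/

theorem Subalgebra.exists_functional {k B : Type*} [Field k] [Ring B] [Algebra k B]
    [Module.Finite k B] [Nontrivial B] (A : Subalgebra k B)
    (hA : Module.finrank k A = Module.finrank k B - 1) :
    ∃ f : B →ₗ[k] k, f ≠ 0 ∧ ∀ t, t ∈ A ↔ f t = 0 := by
  have hpos : 0 < Module.finrank k B := Module.finrank_pos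
  have hne : Subalgebra.toSubmodule A ≠ ⊤ := by
    intro h
    have h1 : Module.finrank k (Subalgebra.toSubmodule A) = Module.finrank k B := by
      rw [h, finrank_top]
    have h2 : Module.finrank k (Subalgebra.toSubmodule A) = Module.finrank k B - 1 := hA
    omega
  obtain ⟨f, hf, hle⟩ := Submodule.exists_le_ker_of_lt_top _ hne.lt_top
  refine ⟨f, hf, fun t => ?_⟩
  have h1 := Module.Dual.finrank_ker_add_one_of_ne_zero hf
  have h2 : Module.finrank k (Subalgebra.toSubmodule A) = Module.finrank k B - 1 := hA
  have : Subalgebra.toSubmodule A = LinearMap.ker f :=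
    Submodule.eq_of_le_of_finrank_eq hle (by omega)
  rw [← Subalgebra.mem_toSubmodule, this, LinearMap.mem_ker]

namespace TruncatedAlgebra

variable {k : Type u} {Q : Type v} [Field k] [Quiver.{w} Q] [Fintype Q]
  {A : Subalgebra k (TruncatedAlgebra k Q 2)} {f : TruncatedAlgebra k Q 2 →ₗ[k] k}

theorem sum_apply_vert (hf : ∀ t, t ∈ A ↔ f t = 0) : ∑ x : Q, f (vert k x) = 0 := by
  rw [← map_sum, sum_vert]
  exact (hf 1).1 A.one_mem

/-- A subalgebra of codimension one that contains all arrows identifies two vertices. -/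
theorem exists_mem_iff_eps_eq (hf0 : f ≠ 0) (hf : ∀ t, t ∈ A ↔ f t = 0)
    (hA : ∀ (x y : Q) (a : x ⟶ y), f (arr k a) = 0) :
    ∃ x y : Q, ∀ t, t ∈ A ↔ eps x t = eps y t := by
  classical
  have hx : ∃ x, f (vert k x) ≠ 0 := by
    by_contra! h
    exact hf0 (lin_ext (fun x => (h x).trans (LinearMap.zero_apply _).symm)
      fun x y a => (hA x y a).trans (LinearMap.zero_apply _).symm)
  obtain ⟨x, hx⟩ := hx
  have hsum := sum_apply_vert hf
  rw [← Finset.add_sum_erase _ _ (Finset.mem_univ x)] at hsum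
  -- Since `f 1 = 0`, the values of `f` on the vertices sum to zero, so a single nonzero value is
  -- impossible.
  obtain ⟨y, hy, hyne⟩ : ∃ y ∈ Finset.univ.erase x, f (vert k y) ≠ 0 := by
    refine Finset.exists_ne_zero_of_sum_ne_zero fun h => hx ?_
    rwa [h, add_zero] at hsum
  have hyx : y ≠ x := Finset.ne_of_mem_erase hy
  -- Correct `vert k z` into `A` once by a multiple of `vert k x` and once by a multiple of `vert k
  -- y`; by orthogonality the product of the two elements is `vert k z` itself.
  have hz (z : Q) (hzx : z ≠ x) (hzy : z ≠ y) : f (vert k z) = 0 := by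
    have h1 : vert k z - (f (vert k z) / f (vert k x)) • vert k x ∈ A := by
      rw [hf, map_sub, map_smul, smul_eq_mul, div_mul_cancel₀ _ hx, sub_self]
    have h2 : vert k z - (f (vert k z) / f (vert k y)) • vert k y ∈ A := by
      rw [hf, map_sub, map_smul, smul_eq_mul, div_mul_cancel₀ _ hyne, sub_self]
    have h3 := A.mul_mem h1 h2
    rw [sub_mul, mul_sub, mul_sub, vert_mul_self, mul_smul_comm, smul_mul_assoc, smul_mul_assoc,
      mul_smul_comm, vert_mul_ne hzy, vert_mul_ne hzx.symm, vert_mul_ne hyx.symm] at h3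
    rw [← hf]
    simpa using h3
  have hxy : f (vert k y) = - f (vert k x) := by
    rw [Finset.sum_eq_single_of_mem y hy fun z h1 h2 => hz z (Finset.ne_of_mem_erase h1) h2] at hsum
    exact (neg_eq_of_add_eq_zero_right hsum).symm
  have hfe : f = f (vert k x) • (eps x - eps y) := by
    refine lin_ext (fun z => ?_) fun p q a => ?_
    · rw [LinearMap.smul_apply, LinearMap.sub_apply]
      by_cases h1 : z = x
      · rw [h1, eps_vert_self, eps_vert_ne hyx, sub_zero, smul_eq_mul, mul_one]
      · rw [eps_vert_ne (Ne.symm h1)]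
        by_cases h2 : z = y
        · rw [h2, eps_vert_self, hxy, zero_sub, smul_eq_mul, mul_neg, mul_one]
        · rw [eps_vert_ne (Ne.symm h2), hz z h1 h2, sub_zero, smul_zero]
    · rw [LinearMap.smul_apply, LinearMap.sub_apply, eps_arr, eps_arr, hA, sub_zero, smul_zero]
  refine ⟨x, y, fun t => ?_⟩
  rw [hf, hfe, LinearMap.smul_apply, LinearMap.sub_apply, smul_eq_mul, mul_eq_zero,
    or_iff_right hx, sub_eq_zero]

section Split

variable {u v : Q} {a : u ⟶ v}

theorem sub_smul_arr_mem (hf : ∀ t, t ∈ A ↔ f t = 0) (ha : f (arr k a) ≠ 0)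
    (t : TruncatedAlgebra k Q 2) : t - (f t / f (arr k a)) • arr k a ∈ A := by
  rw [hf, map_sub, map_smul, smul_eq_mul, div_mul_cancel₀ _ ha, sub_self]

/-- The radical part of `A` is a two-sided ideal of all of `T_2 Q`: any `t` differs from an element
of `A` by a multiple of `a`, and `a` annihilates the radical. -/
theorem apply_mul_eq_zero (hf : ∀ t, t ∈ A ↔ f t = 0) (ha : f (arr k a) ≠ 0)
    {m : TruncatedAlgebra k Q 2} (hm : ∀ x, eps x m = 0) (hfm : f m = 0)
    (t : TruncatedAlgebra k Q 2) : f (t * m) = 0 ∧ f (m * t) = 0 := by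
  have hmA := (hf m).2 hfm
  have h1 := A.mul_mem (sub_smul_arr_mem hf ha t) hmA
  have h2 := A.mul_mem hmA (sub_smul_arr_mem hf ha t)
  rw [sub_mul, smul_mul_assoc, mul_eq_zero_of_eps (fun x => eps_arr x a) hm, smul_zero,
    sub_zero, hf] at h1
  rw [mul_sub, mul_smul_comm, mul_eq_zero_of_eps hm (fun x => eps_arr x a), smul_zero,
    sub_zero, hf] at h2
  exact ⟨h1, h2⟩

/-- Some combination `b - c • a` lies in the radical part of `A`, which is an ideal. Multiplying by
an end vertex of `b` that is not the corresponding end of `a` leaves `b` alone. -/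
theorem apply_arr_eq_zero (hf : ∀ t, t ∈ A ↔ f t = 0) (ha : f (arr k a) ≠ 0) {p q : Q}
    (b : p ⟶ q) (h : ¬(p = u ∧ q = v)) : f (arr k b) = 0 := by
  have hm (x : Q) : eps x (arr k b - (f (arr k b) / f (arr k a)) • arr k a) = 0 := by
    rw [map_sub, map_smul, eps_arr, eps_arr, smul_zero, sub_zero]
  have hfm := (hf _).1 (sub_smul_arr_mem hf ha (arr k b))
  by_cases hp : p = u
  · have h1 := (apply_mul_eq_zero hf ha hm hfm (vert k q)).2
    rwa [sub_mul, smul_mul_assoc, arr_mul_vert, arr_mul_vert_ne a fun hq => h ⟨hp, hq⟩, smul_zero,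
      sub_zero] at h1
  · have h1 := (apply_mul_eq_zero hf ha hm hfm (vert k p)).1
    rwa [mul_sub, mul_smul_comm, vert_mul_arr, vert_mul_arr_ne a hp, smul_zero, sub_zero] at h1

/-- The correction of `vert k x` by a multiple of `a` lies in `A`, and its square is exactly `vert k
x`, because `vert k x` kills `a` on both sides. -/
theorem apply_vert_eq_zero (hf : ∀ t, t ∈ A ↔ f t = 0) (ha : f (arr k a) ≠ 0) {x : Q}
    (hu : x ≠ u) (hv : x ≠ v) : f (vert k x) = 0 := by
  have h1 := sub_smul_arr_mem hf ha (vert k x)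
  have h2 := A.mul_mem h1 h1
  rwa [sub_mul, mul_sub, mul_sub, vert_mul_self, mul_smul_comm, smul_mul_assoc, smul_mul_smul_comm,
    arr_mul_arr, vert_mul_arr_ne a hu, arr_mul_vert_ne a hv, smul_zero, smul_zero, sub_self,
    sub_zero, sub_zero, hf] at h2

end Split

end TruncatedAlgebra

/-! ### Conjugation to split form; from hyperplanes to subalgebras -/

namespace IsAdmissible

variable {k : Type u} {Q : Type v} [Field k] [Quiver.{w} Q] [Fintype Q]
  {I : Ideal (PathAlgebra k Q)} [I.IsTwoSided]
  {A : Subalgebra k (TruncatedAlgebra k Q 2)} {f : TruncatedAlgebra k Q 2 →ₗ[k] k}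

/-- As `a` is not a loop, `a * a = 0` already in `kQ`, so `1 + c • a` is a unit of `B` itself and
the conjugation of `T_2 Q` comes from `Aut_k(B)`. -/
theorem exists_inner (hI : IsAdmissible I) {u v : Q} (a : u ⟶ v) (huv : u ≠ v) (c : k) :
    ∃ φ : (PathAlgebra k Q ⧸ I) ≃ₐ[k] (PathAlgebra k Q ⧸ I), ∀ t,
      hI.induced φ t = (1 + c • arr k a) * t * (1 - c • arr k a) := by
  have h0 : (c • Ideal.Quotient.mk I (arrow k a)) * (c • Ideal.Quotient.mk I (arrow k a)) = 0 := by
    rw [smul_mul_smul_comm, ← map_mul, arrow, ofPath_mul, pathMul_ne huv, map_zero, smul_zero]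
  let b : (PathAlgebra k Q ⧸ I)ˣ :=
    ⟨1 + c • Ideal.Quotient.mk I (arrow k a), 1 - c • Ideal.Quotient.mk I (arrow k a),
      by rw [add_mul, mul_sub, mul_sub, h0, mul_one, mul_one, one_mul]; abel,
      by rw [sub_mul, mul_add, mul_add, h0, mul_one, mul_one, one_mul]; abel⟩
  refine ⟨conjAut k b, fun t => ?_⟩
  obtain ⟨z, rfl⟩ := hI.proj_surjective t
  rw [induced_proj, conjAut_apply, map_mul, map_mul]
  change hI.proj (1 + c • _) * _ * hI.proj (1 - c • _) = _
  rw [map_add, map_sub, map_one, map_smul]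
  rfl

/-- Inner automorphisms by `1 + c • a` fix all arrows, so only the values of `f` on the vertices
must be removed. This puts `ker f` in split form. -/
theorem exists_apply_induced (hI : IsAdmissible I) {u v : Q} {a : u ⟶ v}
    (hf : ∀ t, t ∈ A ↔ f t = 0) (ha : f (arr k a) ≠ 0) :
    ∃ φ : (PathAlgebra k Q ⧸ I) ≃ₐ[k] (PathAlgebra k Q ⧸ I), ∀ t,
      f (hI.induced φ t) = f (arrowSpanMap k u v (arrowProj k u v t)) := by
  classical
  have harr (φ : (PathAlgebra k Q ⧸ I) ≃ₐ[k] (PathAlgebra k Q ⧸ I))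
      (hv : ∀ x, f (hI.induced φ (vert k x)) = 0)
      (hφ : ∀ (p q : Q) (b : p ⟶ q), hI.induced φ (arr k b) = arr k b) (t) :
      f (hI.induced φ t) = f (arrowSpanMap k u v (arrowProj k u v t)) := by
    have : f ∘ₗ (hI.induced φ).toLinearMap = f ∘ₗ arrowSpanMap k u v ∘ₗ arrowProj k u v := by
      refine lin_ext (fun x => ?_) fun p q b => ?_
      · refine (hv x).trans ?_
        change 0 = f (arrowSpanMap k u v (arrowProj k u v _))
        rw [arrowProj_vert, map_zero, map_zero]
      · refine (congrArg f (hφ p q b)).trans ?_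
        change _ = f (arrowSpanMap k u v (arrowProj k u v _))
        by_cases h : p = u ∧ q = v
        · obtain ⟨rfl, rfl⟩ := h
          rw [arrowProj_arr]; rfl
        · rw [arrowProj_arr_ne b h, map_zero, map_zero, apply_arr_eq_zero hf ha b h]
    exact congrArg (fun F => F t) this
  have hsum := sum_apply_vert hf
  by_cases huv : u = v
  -- For a loop, `f` vanishes on every vertex except possibly `u`, and the zero sum then kills `f
  -- (vert k u)` as well: no conjugation is needed.
  · subst huv
    refine ⟨1, harr 1 (fun x => ?_) fun p q b => ?_⟩
    · rw [map_one, AlgEquiv.one_apply]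
      rw [Finset.sum_eq_single_of_mem u (Finset.mem_univ u)
        fun x _ hx => apply_vert_eq_zero hf ha hx hx] at hsum
      by_cases hx : x = u
      · rw [hx, hsum]
      · exact apply_vert_eq_zero hf ha hx hx
    · rw [map_one, AlgEquiv.one_apply]
  -- Conjugation sends `vert k v` to `vert k v + c • a` and `vert k u` to `vert k u - c • a`. This
  -- `c` kills `f` on the first, and then on the second because `f (vert k u) + f (vert k v) = 0`.
  · obtain ⟨φ, hφ⟩ := hI.exists_inner a huv (-(f (vert k v) / f (arr k a)))
    refine ⟨φ, harr φ (fun x => ?_) fun p q b => ?_⟩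
    · have haxa : arr k a * vert k x * arr k a = 0 :=
        mul_eq_zero_of_eps (fun y => by rw [eps_mul, eps_arr, zero_mul]) fun y => eps_arr y a
      rw [hφ, add_mul, one_mul, mul_sub, mul_one, add_mul, smul_mul_assoc, smul_mul_smul_comm,
        haxa, smul_zero, add_zero, mul_smul_comm, map_sub, map_add, map_smul, map_smul]
      by_cases hxu : x = u
      · subst hxu
        rw [Fintype.sum_eq_add x v huv fun y hy => apply_vert_eq_zero hf ha hy.1 hy.2] at hsum
        rw [vert_mul_arr, arr_mul_vert_ne a huv, map_zero, smul_zero, smul_eq_mul, neg_mul,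
          div_mul_cancel₀ _ ha, add_zero, sub_neg_eq_add, hsum]
      · rw [vert_mul_arr_ne a hxu, map_zero, smul_zero, sub_zero]
        by_cases hxv : x = v
        · subst hxv
          rw [arr_mul_vert, smul_eq_mul, neg_mul, div_mul_cancel₀ _ ha, add_neg_cancel]
        · rw [arr_mul_vert_ne a hxv, map_zero, smul_zero, add_zero,
            apply_vert_eq_zero hf ha hxu hxv]
    · rw [hφ, add_mul, one_mul, smul_mul_assoc, arr_mul_arr, smul_zero, add_zero, mul_sub, mul_one,
        mul_smul_comm, arr_mul_arr, smul_zero, sub_zero]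

variable [∀ x y : Q, Finite (x ⟶ y)]

/-- A subalgebra of codimension one that omits an arrow from `u` to `v` is conjugate to one that
contains the vertices and is given by a hyperplane of `u kQ₁ v`. -/
theorem exists_induced_smul_splitMsa (hI : IsAdmissible I) {A : Msa k Q} {u v : Q} {a : u ⟶ v}
    (hf : ∀ t, t ∈ A.1 ↔ f t = 0) (ha : f (arr k a) ≠ 0) :
    ∃ (W : Gr k (Module.finrank k (arrowSpan k u v) - 1) (arrowSpan k u v))
      (φ : (PathAlgebra k Q ⧸ I) ≃ₐ[k] (PathAlgebra k Q ⧸ I)),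
      hI.induced φ • splitMsa ⟨a⟩ W = A := by
  have hg : f ∘ₗ arrowSpanMap k u v ≠ 0 := fun h =>
    ha (congrArg (fun F => F ⟨arrow k a, Submodule.subset_span ⟨a, rfl⟩⟩) h)
  have h1 := Module.Dual.finrank_ker_add_one_of_ne_zero hg
  obtain ⟨φ, hφ⟩ := hI.exists_apply_induced hf ha
  refine ⟨⟨LinearMap.ker (f ∘ₗ arrowSpanMap k u v), by omega⟩, φ,
    Subtype.ext (Subalgebra.ext fun t => ?_)⟩
  rw [hf]
  constructor
  · rintro ⟨s, hs, rfl⟩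
    exact (hφ s).trans hs
  · intro ht
    refine ⟨(hI.induced φ).symm t, ?_, (hI.induced φ).apply_symm_apply t⟩
    refine (hφ _).symm.trans ?_
    rwa [AlgEquiv.apply_symm_apply]

theorem finite_msaOrbits (hI : IsAdmissible I)
    (hfin : ∀ x y : Q, Nonempty (x ⟶ y) →
      Finite (MulAction.orbitRel.Quotient (hI.imageGroup x y)
        (Gr k (Module.finrank k (arrowSpan k x y) - 1) (arrowSpan k x y)))) :
    Finite hI.MsaOrbits := by
  let _ := hI.msaAction
  change Finite (MulAction.orbitRel.Quotient ((PathAlgebra k Q ⧸ I) ≃ₐ[k] (PathAlgebra k Q ⧸ I))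
    (Msa k Q))
  let orb : Msa k Q → MulAction.orbitRel.Quotient
    ((PathAlgebra k Q ⧸ I) ≃ₐ[k] (PathAlgebra k Q ⧸ I)) (Msa k Q) := Quotient.mk _
  have horb (φ : (PathAlgebra k Q ⧸ I) ≃ₐ[k] (PathAlgebra k Q ⧸ I)) (A : Msa k Q) :
      orb (hI.induced φ • A) = orb A := Quotient.sound ((MulAction.orbitRel_apply
      (G := (PathAlgebra k Q ⧸ I) ≃ₐ[k] (PathAlgebra k Q ⧸ I))).2 ⟨φ, rfl⟩)
  -- In the zero algebra the truncated codimension is not genuine and no nonzero functional exists,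
  -- so this case is treated apart.
  rcases subsingleton_or_nontrivial (TruncatedAlgebra k Q 2) with hT | hT
  · have : Subsingleton (Msa k Q) := ⟨fun A B => Subtype.ext (Subalgebra.ext fun t => by
      rw [Subsingleton.elim t 0]
      exact iff_of_true A.1.zero_mem B.1.zero_mem)⟩
    exact Finite.of_surjective orb Quotient.mk_surjective
  have hS : {A : Msa k Q | ∃ x y : Q, ∀ t, t ∈ A.1 ↔ eps x t = eps y t}.Finite := by
    have : {A : Msa k Q | ∃ x y : Q, ∀ t, t ∈ A.1 ↔ eps x t = eps y t} =
        ⋃ x : Q, ⋃ y : Q, {A : Msa k Q | ∀ t, t ∈ A.1 ↔ eps x t = eps y t} := by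
      ext A; simp
    rw [this]
    refine Set.finite_iUnion fun x => Set.finite_iUnion fun y => Set.Subsingleton.finite ?_
    intro A hA B hB
    exact Subtype.ext (Subalgebra.ext fun t => (hA t).trans (hB t).symm)
  let R (p : {p : Q × Q // Nonempty (p.1 ⟶ p.2)}) : Set (Msa k Q) :=
    Set.range fun q : MulAction.orbitRel.Quotient (hI.imageGroup p.1.1 p.1.2)
        (Gr k (Module.finrank k (arrowSpan k p.1.1 p.1.2) - 1) (arrowSpan k p.1.1 p.1.2)) =>
      splitMsa p.2 q.out
  have hR : (⋃ p, R p).Finite := Set.finite_iUnion fun p =>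
    have := hfin p.1.1 p.1.2 p.2
    Set.finite_range _
  refine Set.finite_univ_iff.1 (((hS.union hR).image orb).subset ?_)
  rintro ⟨A⟩ -
  obtain ⟨f, hf0, hf⟩ := A.1.exists_functional A.2
  by_cases hA : ∀ (x y : Q) (a : x ⟶ y), f (arr k a) = 0
  · exact ⟨A, Or.inl (exists_mem_iff_eps_eq hf0 hf hA), rfl⟩
  · push Not at hA
    obtain ⟨u, v, a, ha⟩ := hA
    obtain ⟨W, φ, hφ⟩ := hI.exists_induced_smul_splitMsa hf ha
    let q : MulAction.orbitRel.Quotient (hI.imageGroup u v)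
        (Gr k (Module.finrank k (arrowSpan k u v) - 1) (arrowSpan k u v)) := Quotient.mk _ W
    -- The chosen representative of the orbit of `W` is a translate of `W` by some `ψ` in `H_B`, and
    -- `ψ` carries one split subalgebra to the other.
    obtain ⟨⟨_, ψ, rfl⟩, hψ⟩ := (MulAction.orbitRel_apply
      (G := hI.imageGroup u v)).1 (Quotient.mk_out W)
    refine ⟨splitMsa ⟨a⟩ q.out, Or.inr (Set.mem_iUnion.2 ⟨⟨(u, v), ⟨a⟩⟩, q, rfl⟩), ?_⟩
    change _ = orb A
    rw [← hφ, horb, ← horb ψ.1 (splitMsa ⟨a⟩ W), hI.induced_smul_splitMsa]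
    exact congrArg (fun W => orb (splitMsa ⟨a⟩ W)) hψ.symm

end IsAdmissible

end

theorem theoremt {k : Type u} [Field k] [IsAlgClosed k]
    {Q : Type v} [Quiver.{w} Q] [Fintype Q] [∀ u v : Q, Finite (u ⟶ v)]
    (I : Ideal (PathAlgebra k Q)) [I.IsTwoSided] (hI : IsAdmissible I) :
    Finite hI.MsaOrbits ↔
      ∀ u v : Q, Nonempty (u ⟶ v) →
        Finite (MulAction.orbitRel.Quotient (hI.imageGroup u v)
          (Gr k (Module.finrank k (arrowSpan k u v) - 1) (arrowSpan k u v))) := by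
  exact ⟨fun h _ _ hxy => hI.finite_grassmannian_orbits h hxy, hI.finite_msaOrbits⟩
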